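/- Let $d\ge 1$, $0\le r\le 5$, and let $\eta=\mathrm{diag}(1,\dots,1,-1)$ be the Minkowski metric of signature $(d-1,1)$ on $\mathbb R^d$. Let $\mathbb U_r=(\mathbb R^d)^{\otimes r}$ be the space of rank-$r$ contravariant tensors, with the natural action of $GL(d)=GL(d,\mathbb R)$ and the tensor metric $$\eta_{(a)(b)}F^{(a)}G^{(b)}=\eta_{a_1b_1}\cdots\eta_{a_rb_r}F^{a_1\cdots a_r}G^{b_1\cdots b_r}.$$ Let $O(d-1,1)\subset GL(d)$ be the subgroup preserving $\eta$, and let $\mathbb V\subset\mathbb U_r$ be a $GL(d)$-irreducible subspace. Then: (i) $\mathbb V$ is a finite direct sum $\mathbb V=\bigoplus_i\bar{\mathbb W}_i$ of $O(d-1,1)$-irreducible subspaces. (ii) There is a linear projection $Y$ of $\mathbb U_r$ onto $\mathbb V$ which is a linear combination of index permutations, such that for every direct sum decomposition $\mathbb V=\bigoplus_i\bar{\mathbb W}_i$ into $O(d-1,1)$-irreducible subspaces the following hold. * Each $\bar{\mathbb W}_i$ consists of trace-free tensors times metric factors: there are $t,s\ge 0$ with $2t+s=r$, a $GL(d)$-irreducible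 subspace $\mathbb V'\subset\mathbb U_s$, and an assignment of index positions such that $\bar{\mathbb W}_i$ is exactly the set of tensors $Y[\eta^{\cdot\cdot}\cdots\eta^{\cdot\cdot}f^{\cdots}]$, with $t$ inverse-metric factors placed at the assigned positions and $f$ ranging over the tensors in $\mathbb V'$ all of whose traces vanish. * The $\bar{\mathbb W}_i$ are mutually orthogonal: for $i\ne j$, $F\in\bar{\mathbb W}_i$ and $G\in\bar{\mathbb W}_j$, one has $\eta_{(a)(b)}F^{(a)}G^{(b)}=0$. * The restriction of the tensor metric $\eta_{(a)(b)}$ to each $\bar{\mathbb W}_i$ is non-degenerate. -/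

import Mathlib

/-- The space of rank-`r` contravariant tensors on `ℝ^d`, given by their components
`F^{a₁ ⋯ a_r}` with respect to the standard basis. -/
abbrev Tensor (d r : ℕ) : Type := (Fin r → Fin d) → ℝ

/-- The Minkowski metric `η_{ab} = diag(1, …, 1, -1)` on `ℝ^d`; the last coordinate is time. -/
def minkowski (d : ℕ) : Matrix (Fin d) (Fin d) ℝ :=
  Matrix.diagonal fun a => if (a : ℕ) + 1 = d then -1 else 1

/-- The matrix `minkowski d` is its own inverse, so it also gives the components of the inverse
metric `η^{ab}`. -/
theorem minkowski_mul_self (d : ℕ) : minkowski d * minkowski d = 1 := by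
  rw [minkowski, Matrix.diagonal_mul_diagonal, ← Matrix.diagonal_one]
  congr 1
  funext a
  split_ifs <;> norm_num

/-- The `r`-fold tensor (Kronecker) power of a matrix, `∏ᵢ M_{aᵢ bᵢ}`. -/
def tensorPower {d : ℕ} (r : ℕ) (M : Matrix (Fin d) (Fin d) ℝ) :
    Matrix (Fin r → Fin d) (Fin r → Fin d) ℝ :=
  Matrix.of fun a b => ∏ i, M (a i) (b i)

/-- The tensor metric `η_{(a)(b)} = η_{a₁ b₁} ⋯ η_{a_r b_r}`, as a bilinear form
`(F, G) ↦ ∑ F^{(a)} η_{(a)(b)} G^{(b)}`. -/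
noncomputable def tensorMetric (d r : ℕ) : LinearMap.BilinForm ℝ (Tensor d r) :=
  Matrix.toBilin' (tensorPower r (minkowski d))

/-- The action of `GL(d)` on tensors: `g` acts on every index. -/
noncomputable def glAct {d : ℕ} (r : ℕ) (g : GL (Fin d) ℝ) : Tensor d r →ₗ[ℝ] Tensor d r :=
  Matrix.toLin' (tensorPower r (g : Matrix (Fin d) (Fin d) ℝ))

/-- The Lorentz group `O(d-1,1) ⊂ GL(d)`: the invertible matrices preserving the metric. -/
def lorentzGroup (d : ℕ) : Subgroup (GL (Fin d) ℝ) where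
  carrier := {g | (g : Matrix (Fin d) (Fin d) ℝ).transpose * minkowski d * g = minkowski d}
  one_mem' := by simp
  mul_mem' := by
    intro g h hg hh
    simp only [Set.mem_ofPred_eq, Units.val_mul, Matrix.transpose_mul] at *
    calc _ = (h : Matrix (Fin d) (Fin d) ℝ).transpose *
          ((g : Matrix (Fin d) (Fin d) ℝ).transpose * minkowski d * g) * h := by
            simp only [Matrix.mul_assoc]
      _ = _ := by rw [hg, hh]
  inv_mem' := by
    intro g hg
    simp only [Set.mem_ofPred_eq] at *
    have h1 : (g : Matrix (Fin d) (Fin d) ℝ) * (g⁻¹ : GL (Fin d) ℝ) = 1 := by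
      rw [← Units.val_mul, mul_inv_cancel, Units.val_one]
    have h2 : ((g⁻¹ : GL (Fin d) ℝ) : Matrix (Fin d) (Fin d) ℝ).transpose *
        (g : Matrix (Fin d) (Fin d) ℝ).transpose = 1 := by
      rw [← Matrix.transpose_mul, h1, Matrix.transpose_one]
    calc _ = ((g⁻¹ : GL (Fin d) ℝ) : Matrix (Fin d) (Fin d) ℝ).transpose *
          ((g : Matrix (Fin d) (Fin d) ℝ).transpose * minkowski d * g) *
            (g⁻¹ : GL (Fin d) ℝ) := by rw [hg]
      _ = (((g⁻¹ : GL (Fin d) ℝ) : Matrix (Fin d) (Fin d) ℝ).transpose *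
          (g : Matrix (Fin d) (Fin d) ℝ).transpose) * minkowski d *
            ((g : Matrix (Fin d) (Fin d) ℝ) * (g⁻¹ : GL (Fin d) ℝ)) := by
            simp only [Matrix.mul_assoc]
      _ = _ := by rw [h1, h2, Matrix.one_mul, Matrix.mul_one]

/-- The space `V` of tensors is mapped to itself by all elements of the group `G`. -/
def IsInvariantUnder {d r : ℕ} (G : Subgroup (GL (Fin d) ℝ)) (V : Submodule ℝ (Tensor d r)) :
    Prop :=
  ∀ g ∈ G, ∀ F ∈ V, glAct r g F ∈ V

/-- The space `V` of tensors is `G`-irreducible: it is nonzero and `G`-invariant, and its only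
`G`-invariant subspaces are `0` and `V`. -/
def IsIrreducibleUnder {d r : ℕ} (G : Subgroup (GL (Fin d) ℝ)) (V : Submodule ℝ (Tensor d r)) :
    Prop :=
  V ≠ ⊥ ∧ IsInvariantUnder G V ∧
    ∀ U : Submodule ℝ (Tensor d r), U ≤ V → IsInvariantUnder G U → U = ⊥ ∨ U = V

/-- The family `W` is a decomposition `V = ⨁ᵢ Wᵢ` of `V` into an (internal) direct sum of
`O(d-1,1)`-irreducible subspaces. -/
structure IsLorentzDecomposition {d r m : ℕ} (V : Submodule ℝ (Tensor d r))
    (W : Fin m → Submodule ℝ (Tensor d r)) : Prop where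
  irreducible : ∀ i, IsIrreducibleUnder (lorentzGroup d) (W i)
  independent : iSupIndep W
  span : ⨆ i, W i = V

/-- Rearrangement of the indices of a tensor by a permutation. -/
def permuteIndices (d : ℕ) {r : ℕ} (σ : Equiv.Perm (Fin r)) : Tensor d r →ₗ[ℝ] Tensor d r where
  toFun F := fun a => F (a ∘ σ)
  map_add' _ _ := rfl
  map_smul' _ _ := rfl

/-- The operators on rank-`r` tensors that are linear combinations of index permutations. -/
def permutationAlgebra (d r : ℕ) : Submodule ℝ (Tensor d r →ₗ[ℝ] Tensor d r) :=
  Submodule.span ℝ (Set.range (permuteIndices d))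

/-- All traces of `f` vanish: contracting any two indices with the metric gives zero.  (The values
of `c` at the positions `i` and `j` are overwritten by the summation indices.) -/
def IsTraceFree {d s : ℕ} (f : Tensor d s) : Prop :=
  ∀ i j : Fin s, i ≠ j → ∀ c : Fin s → Fin d,
    ∑ a, ∑ b, minkowski d a b * f (Function.update (Function.update c i a) j b) = 0

/-- The tensor `η^{··} ⋯ η^{··} f^{⋯}`, the product of `t` inverse metrics and a rank-`s` tensor
`f`.  The bijection `σ` says which index position is occupied by which index of which factor;
its existence forces `r = 2 t + s`. -/
def metricMul {d r t s : ℕ} (σ : (Fin t × Fin 2) ⊕ Fin s ≃ Fin r) (f : Tensor d s) :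
    Tensor d r :=
  fun a => (∏ k : Fin t, minkowski d (a (σ (Sum.inl (k, 0)))) (a (σ (Sum.inl (k, 1))))) *
    f fun j => a (σ (Sum.inr j))

/-- With `Y` a symmetrizer, `W` is the space of all tensors `Y[η ⋯ η f]`, where `f` runs over the
trace-free tensors of a fixed symmetry type, i.e. in a fixed `GL(d)`-irreducible space `V'` of
tensors of rank `s = r - 2 t`. -/
def IsMetricTimesTraceFree {d r : ℕ} (Y : Tensor d r →ₗ[ℝ] Tensor d r)
    (W : Submodule ℝ (Tensor d r)) : Prop :=
  ∃ (t s : ℕ) (σ : (Fin t × Fin 2) ⊕ Fin s ≃ Fin r) (V' : Submodule ℝ (Tensor d s)),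
    IsIrreducibleUnder ⊤ V' ∧
      (W : Set (Tensor d r)) = {F | ∃ f ∈ V', IsTraceFree f ∧ F = Y (metricMul σ f)}

/-! Everything is measured against the Euclidean inner product of components. `GL(d)` and `O(d-1,1)`
are both closed under transposition, so the Euclidean complement of an invariant subspace is
invariant: this gives complete reducibility, and the Euclidean projection onto an invariant subspace
commutes with the group. `Y` is the projection onto `V`; by Schur–Weyl duality
(`IsGLInvariant.mem_permSpan`) it is a combination of permutations. Moreover `η` is itself a Lorentz
matrix. Writing `Θ` for its tensor power, the tensor metric is `F ⬝ ΘG` and Lorentz-invariant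
subspaces are `Θ`-stable, so metric orthogonality reduces to Euclidean orthogonality and
non-degeneracy to positive definiteness.

The heart is multiplicity-freeness (`IsIrreducibleUnder.eq_or_orthogonal`): distinct
Lorentz-irreducible subspaces `W`, `W'` of `V` are orthogonal. It suffices that every
Lorentz-equivariant `T = YTY` is symmetric: for the product `pq` of the two projections this says
`pq = qp`, so `pq` has image in `W ⊓ W' = ⊥`. By the first fundamental theorem, `TΘ` is a
combination of Brauer diagrams, that is, of permutations `g` partially transposed at the positions
of one colour. Two-coloured necklaces of length at most five have a reflection symmetry, so `g` is
conjugate to its inverse by a colour-preserving permutation, and the average of `T` over all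
permutations is symmetric. (The necklace 001011 is chiral, so this stops at rank six.) Since `V` is
of real type, `YσY = c(σ)Y`, compressing the average by `Y` returns `T` times `∑ c(σ)² > 0`; hence
`T` is symmetric. Real type itself comes from the same reversal argument, climbing the chain of
symmetric groups (`exists_isRealType`).

For the shape of the pieces: Lorentz-equivariant operators act on trace-free tensors as combinations
of permutations, so the trace-free part of a `GL(d)`-irreducible space is Lorentz-irreducible or
zero. Metrics times trace-free tensors span all tensors, so a nonzero element of a piece pairs
nontrivially with some `Y[η⋯ηf]`. These tensors form an irreducible subspace of `V` not orthogonal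
to the piece, hence equal to it.

Both invariant-theory theorems rest on a Casimir identity: on an invariant, a shifted sum of
transpositions equals a sum of contractions, which induction on the rank controls, and positivity of
a sum of squares makes that operator injective. -/

open Matrix

/-! ### Reversing coloured permutations -/

/-- The involutions of `Fin 5`. -/
def involutionsFive : List (Fin 5 → Fin 5) :=
  [![0,1,2,3,4], ![0,1,2,4,3], ![0,1,3,2,4], ![0,1,4,3,2], ![0,2,1,3,4], ![0,3,2,1,4], 
    ![0,4,2,3,1], ![1,0,2,3,4], ![2,1,0,3,4], ![3,1,2,0,4], ![4,1,2,3,0], ![0,2,1,4,3], 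
    ![0,3,4,1,2], ![0,4,3,2,1], ![1,0,2,4,3], ![3,4,2,0,1], ![4,3,2,1,0], ![1,0,3,2,4], 
    ![2,3,0,1,4], ![3,2,1,0,4], ![1,0,4,3,2], ![2,4,0,3,1], ![4,2,1,3,0], ![2,1,0,4,3], 
    ![3,1,4,0,2], ![4,1,3,2,0]]

theorem involutionsFive_involutive : ∀ k ∈ involutionsFive, ∀ i, k (k i) = i := by
  decide +kernel

/-- Reflecting each cycle is an involution, so the search can be confined to the 26 involutions
instead of all 120 permutations. -/
theorem exists_reversing_five : ∀ g : Equiv.Perm (Fin 5), ∀ c : Fin 5 → Bool,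
    ∃ k ∈ involutionsFive, (∀ i, g (k (g i)) = k i) ∧ (∀ i, c (k i) = c i) ∧
      ∀ i, g i = i → k i = i := by
  decide +kernel

theorem exists_reversing_four : ∀ g : Equiv.Perm (Fin 4), ∀ c : Fin 4 → Bool,
    ∃ k : Equiv.Perm (Fin 4), (∀ i, g (k (g i)) = k i) ∧ (∀ i, c (k i) = c i) ∧
      ∀ i, g i = i → k i = i := by
  decide +kernel

theorem exists_reversing_three : ∀ g : Equiv.Perm (Fin 3), ∀ c : Fin 3 → Bool,
    ∃ k : Equiv.Perm (Fin 3), (∀ i, g (k (g i)) = k i) ∧ (∀ i, c (k i) = c i) ∧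
      ∀ i, g i = i → k i = i := by
  decide +kernel

theorem exists_reversing_two : ∀ g : Equiv.Perm (Fin 2), ∀ c : Fin 2 → Bool,
    ∃ k : Equiv.Perm (Fin 2), (∀ i, g (k (g i)) = k i) ∧ (∀ i, c (k i) = c i) ∧
      ∀ i, g i = i → k i = i := by
  decide +kernel

/-- A permutation of at most five points carrying a two-colouring is conjugate to its inverse by a
permutation that preserves the colours: two-coloured necklaces of length at most five are
achiral. -/
theorem exists_reversing {r : ℕ} (hr : r ≤ 5) (g : Equiv.Perm (Fin r)) (c : Fin r → Bool) :
    ∃ k : Equiv.Perm (Fin r), k * g * k⁻¹ = g⁻¹ ∧ (∀ i, c (k i) = c i) ∧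
      ∀ i, g i = i → k i = i := by
  suffices h : ∃ k : Equiv.Perm (Fin r), (∀ i, g (k (g i)) = k i) ∧ (∀ i, c (k i) = c i) ∧
      ∀ i, g i = i → k i = i by
    obtain ⟨k, h1, h2, h3⟩ := h
    refine ⟨k, ?_, h2, h3⟩
    rw [mul_inv_eq_iff_eq_mul, eq_inv_mul_iff_mul_eq]
    exact Equiv.ext h1
  interval_cases r
  · exact ⟨1, fun i => i.elim0, fun i => i.elim0, fun i => i.elim0⟩
  · exact ⟨1, fun i => Subsingleton.elim _ _, fun i => rfl, fun i _ => rfl⟩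
  · exact exists_reversing_two g c
  · exact exists_reversing_three g c
  · exact exists_reversing_four g c
  · obtain ⟨k, hk, h⟩ := exists_reversing_five g c
    have hi : Function.Involutive k := involutionsFive_involutive k hk
    exact ⟨hi.toPerm k, h⟩

/-! ### Tensor powers and permutation matrices -/

theorem tensorPower_one {d : ℕ} (r : ℕ) :
    tensorPower r (1 : Matrix (Fin d) (Fin d) ℝ) = 1 := by
  ext a b
  simp only [tensorPower, of_apply, one_apply]
  rw [Finset.prod_ite_zero]
  simp [funext_iff]

theorem tensorPower_mul {d : ℕ} (r : ℕ) (M N : Matrix (Fin d) (Fin d) ℝ) :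
    tensorPower r (M * N) = tensorPower r M * tensorPower r N := by
  ext a b
  simp only [tensorPower, of_apply, mul_apply]
  rw [Finset.prod_univ_sum]
  simp [Finset.prod_mul_distrib]

theorem tensorPower_transpose {d : ℕ} (r : ℕ) (M : Matrix (Fin d) (Fin d) ℝ) :
    tensorPower r Mᵀ = (tensorPower r M)ᵀ := rfl

/-- The matrix of the rearrangement of indices by a permutation. -/
def permMatrix (d : ℕ) {r : ℕ} (σ : Equiv.Perm (Fin r)) :
    Matrix (Fin r → Fin d) (Fin r → Fin d) ℝ :=
  Matrix.of fun a b => if a ∘ σ = b then 1 else 0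

theorem permMatrix_mulVec {d r : ℕ} (σ : Equiv.Perm (Fin r)) (F : Tensor d r) :
    permMatrix d σ *ᵥ F = fun a => F (a ∘ σ) := by
  ext a
  simp [permMatrix, mulVec, dotProduct]

theorem permMatrix_mul_apply {d r : ℕ} (σ : Equiv.Perm (Fin r))
    (M : Matrix (Fin r → Fin d) (Fin r → Fin d) ℝ) (a b : Fin r → Fin d) :
    (permMatrix d σ * M) a b = M (a ∘ σ) b := by
  simp [permMatrix, mul_apply]

theorem permMatrix_one (d r : ℕ) : permMatrix d (1 : Equiv.Perm (Fin r)) = 1 := by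
  ext a b
  simp [permMatrix, one_apply]

theorem permMatrix_mul {d r : ℕ} (σ τ : Equiv.Perm (Fin r)) :
    permMatrix d (σ * τ) = permMatrix d σ * permMatrix d τ := by
  ext a b
  rw [permMatrix_mul_apply]
  rfl

theorem permMatrix_transpose {d r : ℕ} (σ : Equiv.Perm (Fin r)) :
    (permMatrix d σ)ᵀ = permMatrix d σ⁻¹ := by
  ext a b
  simp only [permMatrix, transpose_apply, of_apply]
  congr 1
  apply propext
  constructor
  · rintro rfl
    ext i
    simp
  · rintro rfl
    ext i
    simp

theorem mul_permMatrix_apply {d r : ℕ} (σ : Equiv.Perm (Fin r))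
    (M : Matrix (Fin r → Fin d) (Fin r → Fin d) ℝ) (a b : Fin r → Fin d) :
    (M * permMatrix d σ) a b = M a (b ∘ ⇑σ⁻¹) := by
  have := permMatrix_mul_apply σ⁻¹ Mᵀ b a
  rw [← permMatrix_transpose, ← transpose_mul] at this
  exact this

theorem toMatrix'_permuteIndices {d r : ℕ} (σ : Equiv.Perm (Fin r)) :
    Matrix.toLin' (permMatrix d σ) = permuteIndices d σ := by
  apply LinearMap.ext
  intro F
  rw [Matrix.toLin'_apply, permMatrix_mulVec]
  rfl

theorem permMatrix_comm_tensorPower {d r : ℕ} (σ : Equiv.Perm (Fin r))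
    (M : Matrix (Fin d) (Fin d) ℝ) :
    permMatrix d σ * tensorPower r M = tensorPower r M * permMatrix d σ := by
  ext a b
  rw [permMatrix_mul_apply, mul_permMatrix_apply]
  simp only [tensorPower, of_apply, Function.comp]
  rw [← Equiv.prod_comp σ (fun i => M (a i) (b (σ⁻¹ i)))]
  simp

/-- The span of the permutation matrices of the permutations satisfying `p`. -/
def permSpan (d r : ℕ) (p : Equiv.Perm (Fin r) → Prop) :
    Submodule ℝ (Matrix (Fin r → Fin d) (Fin r → Fin d) ℝ) :=
  Submodule.span ℝ {M | ∃ σ, p σ ∧ M = permMatrix d σ}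

/-! ### The Casimir identity -/

section Casimir

variable {d k : ℕ}

/-- The action of the elementary matrix `E_{pq}` on tensors as a derivation. -/
def elemDeriv (p q : Fin d) (φ : Tensor d k) : Tensor d k :=
  fun a => ∑ i, if a i = p then φ (Function.update a i q) else 0

/-- The sum of all transpositions `i ≠ j` of indices (each transposition counted twice). -/
def swapSum (φ : Tensor d k) : Tensor d k :=
  fun a => ∑ i, ∑ j, if i = j then 0 else φ (a ∘ Equiv.swap i j)

theorem sum_elemDeriv_comp (F : Fin d → Fin d → Tensor d k) (a : Fin k → Fin d) :
    ∑ p, ∑ q, elemDeriv q p (F p q) a = ∑ p, ∑ i, F p (a i) (Function.update a i p) := by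
  refine Finset.sum_congr rfl fun p _ => ?_
  simp only [elemDeriv]
  rw [Finset.sum_comm]
  refine Finset.sum_congr rfl fun i _ => ?_
  simp

theorem update_update_eq_comp_swap (a : Fin k → Fin d) (i j : Fin k) (h : i ≠ j) :
    Function.update (Function.update a i (a j)) j (a i) = a ∘ Equiv.swap i j := by
  rw [Equiv.comp_swap_eq_update, Function.update_comm h.symm]

/-- When both derivations hit the same slot the result is `d * φ a`; when they hit different slots
`i`, `j` the two index values are exchanged. -/
theorem sum_elemDeriv_elemDeriv (φ : Tensor d k) (a : Fin k → Fin d) :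
    ∑ p, ∑ q, elemDeriv q p (elemDeriv p q φ) a = (k * d : ℝ) * φ a + swapSum φ a := by
  rw [sum_elemDeriv_comp (fun p q => elemDeriv p q φ), Finset.sum_comm]
  have key : ∀ i : Fin k, ∑ p, elemDeriv p (a i) φ (Function.update a i p) =
      d * φ a + ∑ j, if i = j then 0 else φ (a ∘ Equiv.swap i j) := by
    intro i
    simp only [elemDeriv]
    rw [Finset.sum_comm, ← Finset.add_sum_erase _ _ (Finset.mem_univ i),
      ← Finset.add_sum_erase _ (fun j => if i = j then 0 else φ (a ∘ Equiv.swap i j))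
        (Finset.mem_univ i)]
    simp only [if_true, zero_add]
    congr 1
    · simp
    · refine Finset.sum_congr rfl fun j hj => ?_
      have hij : i ≠ j := (Finset.ne_of_mem_erase hj).symm
      rw [if_neg hij]
      simp only [Function.update_of_ne hij.symm]
      rw [Finset.sum_ite_eq, if_pos (Finset.mem_univ _), update_update_eq_comp_swap a i j hij]
  simp only [key, Finset.sum_add_distrib, swapSum]
  simp [mul_assoc]

/-- The adjoint of `E_{qp}` is `E_{pq}`, so the Casimir quadratic form becomes a sum of squares. -/
theorem sum_mul_elemDeriv (p q : Fin d) (φ ψ : Tensor d k) :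
    ∑ a, φ a * elemDeriv q p ψ a = ∑ a, elemDeriv p q φ a * ψ a := by
  simp only [elemDeriv, Finset.mul_sum, Finset.sum_mul]
  rw [Finset.sum_comm, Finset.sum_comm (s := Finset.univ (α := Fin k → Fin d))]
  refine Finset.sum_congr rfl fun i _ => ?_
  simp only [mul_ite, mul_zero, ite_mul, zero_mul]
  rw [← Finset.sum_filter, ← Finset.sum_filter]
  refine Finset.sum_bij' (fun a _ => Function.update a i p) (fun a _ => Function.update a i q)
    ?_ ?_ ?_ ?_ ?_
  · simp
  · simp
  · intro a ha
    have : a i = q := by simpa using ha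
    simp [← this]
  · intro a ha
    have : a i = p := by simpa using ha
    simp [← this]
  · intro a ha
    have : a i = q := by simpa using ha
    simp [← this]

/-- The number of indices of `a` that are equal to `p`. -/
def indexCount (a : Fin k → Fin d) (p : Fin d) : ℕ := ∑ i, if a i = p then 1 else 0

theorem elemDeriv_self (p : Fin d) (φ : Tensor d k) (a : Fin k → Fin d) :
    elemDeriv p p φ a = indexCount a p * φ a := by
  simp only [elemDeriv, indexCount, Nat.cast_sum, Finset.sum_mul]
  refine Finset.sum_congr rfl fun i _ => ?_
  split_ifs with h
  · simp [← h]
  · simp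

theorem sum_indexCount (a : Fin k → Fin d) : ∑ p, indexCount a p = k := by
  simp only [indexCount]
  rw [Finset.sum_comm]
  simp

/-- The right side is `∑_{p,q} ‖E_{pq} φ‖²`. Only the diagonal terms `p = q` are kept, where
`E_{pp}` multiplies by the number of occurrences of `p`. -/
theorem sum_sq_indexCount_le (φ : Tensor d k) :
    ∑ a, (∑ p, (indexCount a p : ℝ) ^ 2) * φ a ^ 2 ≤
      ∑ a, φ a * ((k * d : ℝ) * φ a + swapSum φ a) := by
  have h1 : ∑ a, φ a * ((k * d : ℝ) * φ a + swapSum φ a) =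
      ∑ p, ∑ q, ∑ a, elemDeriv p q φ a ^ 2 := by
    simp only [← sum_elemDeriv_elemDeriv, Finset.mul_sum]
    rw [Finset.sum_comm]
    refine Finset.sum_congr rfl fun p _ => ?_
    rw [Finset.sum_comm]
    refine Finset.sum_congr rfl fun q _ => ?_
    rw [sum_mul_elemDeriv]
    simp [pow_two]
  rw [h1]
  simp only [Finset.sum_mul]
  rw [Finset.sum_comm]
  refine Finset.sum_le_sum fun p _ => ?_
  refine le_trans (le_of_eq ?_) (Finset.single_le_sum (f := fun q => ∑ a, elemDeriv p q φ a ^ 2)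
    (fun q _ => Finset.sum_nonneg fun a _ => sq_nonneg _) (Finset.mem_univ p))
  simp only [elemDeriv_self, mul_pow]

/-- A tensor is evenly supported if its component `φ^{a}` vanishes whenever some value occurs an
odd number of times in `a`. -/
def evenlySupported (d k : ℕ) : Submodule ℝ (Tensor d k) where
  carrier := {φ | ∀ a, φ a ≠ 0 → ∀ p, Even (indexCount a p)}
  zero_mem' a h := absurd rfl h
  add_mem' := by
    intro φ ψ hφ hψ a h
    by_cases h1 : φ a = 0
    · exact hψ a (by simpa [h1] using h)
    · exact hφ a h1
  smul_mem' := by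
    intro c φ hφ a h
    exact hφ a (right_ne_zero_of_mul h)

theorem eq_zero_of_sum_nonpos {ι : Type*} [Fintype ι] (w φ : ι → ℝ)
    (hw : ∀ a, φ a ≠ 0 → 0 < w a) (h : ∑ a, w a * φ a ^ 2 ≤ 0) : φ = 0 := by
  have hn : ∀ a, 0 ≤ w a * φ a ^ 2 := by
    intro a
    by_cases h0 : φ a = 0
    · simp [h0]
    · exact (mul_pos (hw a h0) (by positivity)).le
  have h2 : ∑ a, w a * φ a ^ 2 = 0 := le_antisymm h (Finset.sum_nonneg fun a _ => hn a)
  rw [Finset.sum_eq_zero_iff_of_nonneg fun a _ => hn a] at h2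
  ext a
  by_contra h0
  change φ a ≠ 0 at h0
  exact (mul_pos (hw a h0) (by positivity : 0 < φ a ^ 2)).ne' (h2 a (Finset.mem_univ a))

/-- Injectivity of the shifted Casimir operator on tensors of positive rank. -/
theorem eq_zero_of_casimir_eq_zero (hk : 0 < k) (φ : Tensor d k)
    (h : ∀ a, (k * d : ℝ) * φ a + swapSum φ a = 0) : φ = 0 := by
  refine eq_zero_of_sum_nonpos (fun a => ∑ p, (indexCount a p : ℝ) ^ 2) φ ?_ ?_
  · intro a _
    have := sum_indexCount a
    by_contra! hc
    have h0 : ∀ p, indexCount a p = 0 := by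
      intro p
      have := (Finset.sum_eq_zero_iff_of_nonneg (fun p _ => sq_nonneg (indexCount a p : ℝ))).1
        (le_antisymm hc (Finset.sum_nonneg fun p _ => sq_nonneg _)) p (Finset.mem_univ p)
      simpa using this
    simp [h0] at this
    omega
  · refine (sum_sq_indexCount_le φ).trans ?_
    simp [h]

/-- Injectivity of the orthogonal Casimir operator on evenly supported tensors of positive rank. -/
theorem eq_zero_of_orthogonalCasimir_eq_zero (hk : 0 < k) (φ : Tensor d k)
    (hφ : φ ∈ evenlySupported d k)
    (h : ∀ a, (k * d - k : ℝ) * φ a + swapSum φ a = 0) : φ = 0 := by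
  refine eq_zero_of_sum_nonpos
    (fun a => ∑ p, ((indexCount a p : ℝ) ^ 2 - indexCount a p)) φ ?_ ?_
  · intro a ha
    have hs := sum_indexCount a
    obtain ⟨p, -, hp⟩ : ∃ p ∈ Finset.univ, indexCount a p ≠ 0 := by
      by_contra! hc
      rw [Finset.sum_eq_zero hc] at hs
      omega
    -- Parity is essential: it makes `n² - n` positive for some count `n`. Without it, the volume
    -- form (`k = d`, all counts 1) lies in the kernel.
    have h2 : 2 ≤ indexCount a p := by
      have := hφ a ha p
      rcases this with ⟨m, hm⟩
      omega
    refine Finset.sum_pos' (fun q _ => ?_) ⟨p, Finset.mem_univ p, ?_⟩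
    · rcases Nat.eq_zero_or_pos (indexCount a q) with h0 | h0
      · simp [h0]
      · have : (1 : ℝ) ≤ indexCount a q := by exact_mod_cast h0
        nlinarith
    · have : (2 : ℝ) ≤ indexCount a p := by exact_mod_cast h2
      nlinarith
  · have h1 := sum_sq_indexCount_le φ
    have h3 : ∀ a, (k * d : ℝ) * φ a + swapSum φ a = k * φ a := fun a => by linarith [h a]
    simp only [h3] at h1
    have h4 : ∀ a : Fin k → Fin d, ∑ p, (indexCount a p : ℝ) = k := fun a => by
      exact_mod_cast sum_indexCount a
    simp only [Finset.sum_sub_distrib, h4, sub_mul]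
    have h5 : ∑ a, φ a * (k * φ a) = ∑ a, (k : ℝ) * φ a ^ 2 :=
      Finset.sum_congr rfl fun a _ => by ring
    linarith

/-! ### Differentiating invariance -/

/-- The derivative at the identity of `M ↦ tensorPower k M` in the direction `X`. -/
def tensorDeriv (k : ℕ) (X : Matrix (Fin d) (Fin d) ℝ) :
    Matrix (Fin k → Fin d) (Fin k → Fin d) ℝ :=
  Matrix.of fun a b => ∑ i, (∏ j ∈ Finset.univ.erase i, if a j = b j then 1 else 0) * X (a i) (b i)

theorem hasDerivAt_tensorPower (g : ℝ → Matrix (Fin d) (Fin d) ℝ) (X : Matrix (Fin d) (Fin d) ℝ)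
    (h0 : g 0 = 1) (hg : ∀ p q, HasDerivAt (fun t => g t p q) (X p q) 0) (a b : Fin k → Fin d) :
    HasDerivAt (fun t => tensorPower k (g t) a b) (tensorDeriv k X a b) 0 := by
  have := HasDerivAt.fun_finsetProd (u := Finset.univ) (x := (0 : ℝ))
    (f := fun i t => g t (a i) (b i)) (f' := fun i => X (a i) (b i))
    (fun i _ => hg (a i) (b i))
  simpa [tensorPower, tensorDeriv, h0, one_apply] using this

theorem tensorDeriv_mulVec (X : Matrix (Fin d) (Fin d) ℝ) (φ : Tensor d k) :
    tensorDeriv k X *ᵥ φ = fun a => ∑ i, ∑ q, X (a i) q * φ (Function.update a i q) := by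
  ext a
  simp only [mulVec, dotProduct, tensorDeriv, of_apply, Finset.sum_mul]
  rw [Finset.sum_comm]
  refine Finset.sum_congr rfl fun i _ => ?_
  symm
  refine Finset.sum_of_injOn (fun q => Function.update a i q) ?_ ?_ ?_ ?_
  · intro p _ q _ h
    simpa using congrFun h i
  · simp
  · intro b _ hb
    have : ∃ j ∈ Finset.univ.erase i, a j ≠ b j := by
      by_contra! hc
      apply hb
      refine ⟨b i, by simp, ?_⟩
      ext j
      by_cases hj : j = i
      · subst hj; simp
      · simp only [Function.update_of_ne hj]
        rw [hc j (by simp [hj])]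
    obtain ⟨j, hj, hne⟩ := this
    rw [Finset.prod_eq_zero hj (by simp [hne])]
    ring
  · intro q _
    rw [Finset.prod_eq_one]
    · simp
    · intro j hj
      simp [Function.update_of_ne (Finset.ne_of_mem_erase hj)]

end Casimir

/-! ### The first fundamental theorem for the Lorentz group -/

section Lorentz

variable {d k : ℕ}

/-- The diagonal entries of the Minkowski metric. -/
def minkowskiSign (d : ℕ) (a : Fin d) : ℝ := if (a : ℕ) + 1 = d then -1 else 1

theorem minkowski_eq_diagonal (d : ℕ) : minkowski d = diagonal (minkowskiSign d) := rfl

theorem minkowski_apply (a b : Fin d) :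
    minkowski d a b = if a = b then minkowskiSign d a else 0 := by
  rw [minkowski_eq_diagonal, diagonal_apply]

theorem minkowski_symm (a b : Fin d) : minkowski d a b = minkowski d b a := by
  rw [minkowski_apply, minkowski_apply]
  by_cases h : a = b
  · subst h; rfl
  · rw [if_neg h, if_neg (Ne.symm h)]

theorem minkowskiSign_mul_self (a : Fin d) : minkowskiSign d a * minkowskiSign d a = 1 := by
  unfold minkowskiSign
  split_ifs <;> norm_num

/-- The matrix `g` preserves the metric. -/
def IsLorentz (g : Matrix (Fin d) (Fin d) ℝ) : Prop := gᵀ * minkowski d * g = minkowski d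

theorem minkowski_transpose (d : ℕ) : (minkowski d)ᵀ = minkowski d := by
  rw [minkowski_eq_diagonal, diagonal_transpose]

theorem isLorentz_diagonal (f : Fin d → ℝ) (hf : ∀ a, f a * f a = 1) :
    IsLorentz (diagonal f) := by
  rw [IsLorentz, diagonal_transpose, minkowski_eq_diagonal, diagonal_mul_diagonal,
    diagonal_mul_diagonal]
  congr 1
  ext a
  rw [mul_right_comm, hf, one_mul]

/-- The generator of the rotation or boost in the plane of `p` and `q`. -/
def planeGenerator (p q : Fin d) : Matrix (Fin d) (Fin d) ℝ :=
  minkowskiSign d q • Matrix.single p q 1 - minkowskiSign d p • Matrix.single q p 1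

/-- The curve is `1 + (c - 1)N + sX`, with `N` the projection to the plane and `X² = -η_p η_q N`. It
is a rotation (cos, sin) when the two signs agree and a boost (cosh, sinh) when they differ. -/
theorem exists_lorentz_curve (p q : Fin d) (h : p ≠ q) :
    ∃ g : ℝ → Matrix (Fin d) (Fin d) ℝ, g 0 = 1 ∧ (∀ t, IsLorentz (g t)) ∧
      ∀ a b, HasDerivAt (fun t => g t a b) (planeGenerator p q a b) 0 := by
  obtain ⟨c, s, hc0, hs0, hcs, hc, hs⟩ : ∃ c s : ℝ → ℝ, c 0 = 1 ∧ s 0 = 0 ∧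
      (∀ t, c t * c t + minkowskiSign d p * minkowskiSign d q * (s t * s t) = 1) ∧
      HasDerivAt c 0 0 ∧ HasDerivAt s 1 0 := by
    have h1 : minkowskiSign d p * minkowskiSign d q = 1 ∨
        minkowskiSign d p * minkowskiSign d q = -1 := by
      unfold minkowskiSign
      split_ifs <;> norm_num
    rcases h1 with h1 | h1 <;> rw [h1]
    · refine ⟨Real.cos, Real.sin, Real.cos_zero, Real.sin_zero, fun t => ?_, ?_, ?_⟩
      · nlinarith [Real.sin_sq_add_cos_sq t]
      · simpa using Real.hasDerivAt_cos 0
      · simpa using Real.hasDerivAt_sin 0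
    · refine ⟨Real.cosh, Real.sinh, Real.cosh_zero, Real.sinh_zero, fun t => ?_, ?_, ?_⟩
      · nlinarith [Real.cosh_sq t]
      · simpa using Real.hasDerivAt_cosh 0
      · simpa using Real.hasDerivAt_sinh 0
  set X := planeGenerator p q with hX
  set N : Matrix (Fin d) (Fin d) ℝ := Matrix.single p p 1 + Matrix.single q q 1 with hN
  have hNN : N * N = N := by
    simp [hN, mul_add, add_mul, Matrix.single_mul_single_same, Matrix.single_mul_single_of_ne,
      h, h.symm]
  have hNX : N * X = X := by
    simp [hN, hX, planeGenerator, mul_sub, add_mul, Matrix.single_mul_single_same,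
      Matrix.single_mul_single_of_ne, h, h.symm]
  have hXN : X * N = X := by
    simp [hN, hX, planeGenerator, mul_add, sub_mul, Matrix.single_mul_single_same,
      Matrix.single_mul_single_of_ne, h, h.symm]
    abel
  have hXX : X * X = -(minkowskiSign d p * minkowskiSign d q) • N := by
    simp [hN, hX, planeGenerator, mul_sub, sub_mul, Matrix.single_mul_single_same,
      Matrix.single_mul_single_of_ne, h, h.symm, mul_comm]
    abel
  have hNη : Nᵀ * minkowski d = minkowski d * N := by
    ext a b
    simp only [hN, minkowski_eq_diagonal, transpose_add, add_mul, mul_add, Matrix.transpose_single,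
      Matrix.mul_diagonal, Matrix.diagonal_mul, Matrix.single_apply, Matrix.add_apply]
    clear hNN hNX hXN hXX hc hs hcs
    grind
  have hXη : Xᵀ * minkowski d = -(minkowski d * X) := by
    ext a b
    simp only [hX, planeGenerator, minkowski_eq_diagonal, transpose_sub, transpose_smul,
      Matrix.transpose_single, Matrix.mul_diagonal, Matrix.diagonal_mul, Matrix.single_apply,
      Matrix.sub_apply, Matrix.neg_apply, Matrix.smul_apply, smul_eq_mul]
    split_ifs <;> simp_all [mul_comm]
  refine ⟨fun t => 1 + (c t - 1) • N + s t • X, by simp [hc0, hs0], fun t => ?_, fun a b => ?_⟩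
  · have e1 : (1 + (c t - 1) • N + s t • X)ᵀ * minkowski d =
        minkowski d * (1 + (c t - 1) • N - s t • X) := by
      simp only [transpose_add, transpose_smul, transpose_one, Matrix.add_mul, Matrix.smul_mul,
        hNη, hXη, Matrix.mul_neg, Matrix.mul_add, Matrix.mul_smul, Matrix.one_mul,
        Matrix.mul_one, smul_neg, sub_eq_add_neg]
    rw [IsLorentz, e1, Matrix.mul_assoc]
    have e2 : (1 + (c t - 1) • N - s t • X) * (1 + (c t - 1) • N + s t • X) = 1 := by
      have e3 : (1 + (c t - 1) • N - s t • X) * (1 + (c t - 1) • N + s t • X) =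
          1 + (c t * c t + minkowskiSign d p * minkowskiSign d q * (s t * s t) - 1) • N := by
        simp only [Matrix.add_mul, Matrix.sub_mul, Matrix.mul_add, Matrix.mul_smul,
          Matrix.smul_mul, Matrix.one_mul, Matrix.mul_one, hNN, hNX, hXN, hXX]
        module
      rw [e3, hcs, sub_self, zero_smul, add_zero]
    rw [e2, Matrix.mul_one]
  · have h1 := ((hc.sub_const 1).mul_const (N a b)).add (hs.mul_const (X a b))
    have h2 := h1.const_add ((1 : Matrix (Fin d) (Fin d) ℝ) a b)
    simp only [zero_mul, one_mul, zero_add] at h2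
    refine h2.congr_of_eventuallyEq (Filter.Eventually.of_forall fun t => ?_)
    simp [add_assoc]

/-- The tensor `φ` is invariant under all matrices preserving the metric. -/
def IsLorentzInvariant (φ : Tensor d k) : Prop :=
  ∀ g : Matrix (Fin d) (Fin d) ℝ, IsLorentz g → tensorPower k g *ᵥ φ = φ

/-- The derivative at 0 of invariance along a rotation or boost: the generator `η_q E_{pq} - η_p
E_{qp}` annihilates `φ`. -/
theorem IsLorentzInvariant.elemDeriv_eq {φ : Tensor d k} (hφ : IsLorentzInvariant φ)
    (p q : Fin d) (a : Fin k → Fin d) :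
    elemDeriv p q φ a =
      minkowskiSign d p * minkowskiSign d q * elemDeriv q p φ a := by
  by_cases hpq : p = q
  · subst hpq
    rw [minkowskiSign_mul_self, one_mul]
  obtain ⟨g, h0, hg, hd⟩ := exists_lorentz_curve p q hpq
  have h1 : HasDerivAt (fun t => (tensorPower k (g t) *ᵥ φ) a)
      ((tensorDeriv k (planeGenerator p q) *ᵥ φ) a) 0 := by
    simp only [mulVec, dotProduct]
    exact HasDerivAt.fun_sum fun b _ => (hasDerivAt_tensorPower g _ h0 hd a b).mul_const _
  have h2 : (fun t => (tensorPower k (g t) *ᵥ φ) a) = fun _ => φ a := by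
    ext t
    rw [hφ _ (hg t)]
  rw [h2] at h1
  have h3 := h1.unique (hasDerivAt_const 0 (φ a))
  rw [tensorDeriv_mulVec] at h3
  beta_reduce at h3
  have h4 : ∑ i, ∑ s, planeGenerator p q (a i) s * φ (Function.update a i s) =
      minkowskiSign d q * elemDeriv p q φ a - minkowskiSign d p * elemDeriv q p φ a := by
    simp only [elemDeriv, Finset.mul_sum, ← Finset.sum_sub_distrib]
    refine Finset.sum_congr rfl fun i _ => ?_
    simp only [planeGenerator, Matrix.sub_apply, Matrix.smul_apply, smul_eq_mul, sub_mul,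
      Finset.sum_sub_distrib, Matrix.single_apply]
    congr 1
    · by_cases h : a i = p
      · simp [h]
      · simp [h, Ne.symm h]
    · by_cases h : a i = q
      · simp [h]
      · simp [h, Ne.symm h]
  rw [h4] at h3
  linear_combination minkowskiSign d q * h3 - (elemDeriv p q φ a) * minkowskiSign_mul_self (d := d) q

/-- Reflection of the coordinate `p` multiplies the component at `a` by `(-1) ^ indexCount a p`. -/
theorem IsLorentzInvariant.evenlySupported {φ : Tensor d k} (hφ : IsLorentzInvariant φ) :
    φ ∈ evenlySupported d k := by
  intro a ha p
  have hl := isLorentz_diagonal (d := d) (fun q => if q = p then -1 else 1)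
    (fun q => by split_ifs <;> norm_num)
  have h1 := congrFun (hφ _ hl) a
  have h2 : (tensorPower k (diagonal fun q => if q = p then (-1 : ℝ) else 1) *ᵥ φ) a =
      (-1) ^ indexCount a p * φ a := by
    simp only [mulVec, dotProduct]
    rw [Finset.sum_eq_single a]
    · congr 1
      simp only [tensorPower, of_apply, diagonal_apply_eq, indexCount]
      rw [← Finset.prod_pow_eq_pow_sum]
      refine Finset.prod_congr rfl fun i _ => ?_
      split_ifs <;> simp
    · intro b _ hb
      obtain ⟨i, hi⟩ := Function.ne_iff.1 hb
      rw [tensorPower, of_apply, Finset.prod_eq_zero (Finset.mem_univ i), zero_mul]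
      exact diagonal_apply_ne _ (Ne.symm hi)
    · simp
  rw [h2] at h1
  have h3 : (-1 : ℝ) ^ indexCount a p = 1 := by
    field_simp at h1
    exact h1
  by_contra h4
  rw [Nat.not_even_iff_odd] at h4
  rw [h4.neg_one_pow] at h3
  norm_num at h3

/-- The metric with indices `i`, `j` times the trace of `φ` over these indices. -/
def metricTrace (i j : Fin k) (φ : Tensor d k) : Tensor d k :=
  fun a => minkowski d (a i) (a j) *
    ∑ p, minkowskiSign d p * φ (Function.update (Function.update a i p) j p)

/-- Invariance replaces the inner `E_{pq}` by `η_p η_q E_{qp}` in the Casimir sum. Slots `i = j`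
then contribute `k * φ a`, whence the shift by `-k`, and slots `i ≠ j` contribute metric traces. -/
theorem IsLorentzInvariant.casimir {φ : Tensor d k} (hφ : IsLorentzInvariant φ)
    (a : Fin k → Fin d) : (k * d - k : ℝ) * φ a + swapSum φ a =
      ∑ i, ∑ j, if i = j then 0 else metricTrace i j φ a := by
  have h1 := sum_elemDeriv_elemDeriv φ a
  have h2 : ∀ p q, elemDeriv p q φ =
      fun a => minkowskiSign d p * minkowskiSign d q * elemDeriv q p φ a :=
    fun p q => funext fun a => hφ.elemDeriv_eq p q a
  rw [show (fun p => ∑ q, elemDeriv q p (elemDeriv p q φ) a) = fun p => ∑ q, elemDeriv q p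
    (fun a => minkowskiSign d p * minkowskiSign d q * elemDeriv q p φ a) a from
    funext fun p => Finset.sum_congr rfl fun q _ => by rw [h2 p q],
    sum_elemDeriv_comp (fun p q a => minkowskiSign d p * minkowskiSign d q * elemDeriv q p φ a),
    Finset.sum_comm] at h1
  have h3 : ∀ i, ∑ p, minkowskiSign d p * minkowskiSign d (a i) *
      elemDeriv (a i) p φ (Function.update a i p) =
      φ a + ∑ j, if i = j then 0 else metricTrace i j φ a := by
    intro i
    simp only [elemDeriv, Finset.mul_sum]
    rw [Finset.sum_comm, ← Finset.add_sum_erase _ _ (Finset.mem_univ i),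
      ← Finset.add_sum_erase _ (fun j => if i = j then 0 else metricTrace i j φ a)
        (Finset.mem_univ i)]
    simp only [if_true, zero_add]
    congr 1
    · simp [minkowskiSign_mul_self]
    · refine Finset.sum_congr rfl fun j hj => ?_
      have hij : i ≠ j := (Finset.ne_of_mem_erase hj).symm
      rw [if_neg hij, metricTrace, minkowski_apply]
      simp only [Function.update_of_ne hij.symm]
      by_cases haij : a i = a j
      · rw [if_pos haij, Finset.mul_sum]
        refine Finset.sum_congr rfl fun p _ => ?_
        rw [if_pos haij.symm]
        ring
      · simp [haij, Ne.symm haij]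
  simp only [h3, Finset.sum_add_distrib] at h1
  simp only [Finset.sum_const, Finset.card_univ, Fintype.card_fin, nsmul_eq_mul] at h1
  linarith

end Lorentz

/-! ### Lorentz-invariant tensors are spanned by products of metrics. -/

section LorentzInvariants

variable {d k : ℕ}

theorem sum_vecCons {β : Type*} [AddCommMonoid β] (f : (Fin (k + 1) → Fin d) → β) :
    ∑ c, f c = ∑ x, ∑ b : Fin k → Fin d, f (vecCons x b) := by
  rw [← (Fin.consEquiv (fun _ => Fin d)).sum_comp, Fintype.sum_prod_type]
  rfl

theorem tensorPower_vecCons (g : Matrix (Fin d) (Fin d) ℝ) (x y : Fin d) (a b : Fin k → Fin d) :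
    tensorPower (k + 1) g (vecCons x a) (vecCons y b) = g x y * tensorPower k g a b := by
  simp [tensorPower, Fin.prod_univ_succ]

/-- The trace over the first two indices. -/
def traceHead (φ : Tensor d (k + 2)) : Tensor d k :=
  fun a => ∑ p, minkowskiSign d p * φ (vecCons p (vecCons p a))

theorem sum_minkowskiSign_of_isLorentz {g : Matrix (Fin d) (Fin d) ℝ} (hg : IsLorentz g)
    (x y : Fin d) : ∑ p, minkowskiSign d p * (g p x * g p y) = minkowski d x y := by
  have := congrFun (congrFun hg x) y
  rw [← this, minkowski_eq_diagonal, Matrix.mul_assoc, mul_apply]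
  simp only [diagonal_mul, transpose_apply]
  exact Finset.sum_congr rfl fun p _ => by ring

theorem sum_minkowski_mul (x : Fin d) (f : Fin d → ℝ) :
    ∑ y, minkowski d x y * f y = minkowskiSign d x * f x := by
  simp [minkowski_apply]

theorem IsLorentzInvariant.traceHead {φ : Tensor d (k + 2)} (hφ : IsLorentzInvariant φ) :
    IsLorentzInvariant (traceHead φ) := by
  intro g hg
  ext a
  have h1 : ∀ p, φ (vecCons p (vecCons p a)) = ∑ x, ∑ y, ∑ b,
      g p x * (g p y * tensorPower k g a b) * φ (vecCons x (vecCons y b)) := by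
    intro p
    conv_lhs => rw [← hφ g hg]
    simp only [mulVec, dotProduct]
    rw [sum_vecCons]
    refine Finset.sum_congr rfl fun x _ => ?_
    rw [sum_vecCons]
    simp only [tensorPower_vecCons]
  calc (tensorPower k g *ᵥ _root_.traceHead φ) a
      = ∑ x, ∑ y, minkowski d x y * ∑ b, tensorPower k g a b * φ (vecCons x (vecCons y b)) := by
        simp only [sum_minkowski_mul]
        simp only [mulVec, dotProduct, _root_.traceHead, Finset.mul_sum]
        rw [Finset.sum_comm]
        exact Finset.sum_congr rfl fun x _ => Finset.sum_congr rfl fun b _ => by ring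
    _ = ∑ x, ∑ y, ∑ p, minkowskiSign d p *
          ∑ b, g p x * (g p y * tensorPower k g a b) * φ (vecCons x (vecCons y b)) := by
        refine Finset.sum_congr rfl fun x _ => Finset.sum_congr rfl fun y _ => ?_
        rw [← sum_minkowskiSign_of_isLorentz hg, Finset.sum_mul]
        refine Finset.sum_congr rfl fun p _ => ?_
        simp only [Finset.mul_sum]
        exact Finset.sum_congr rfl fun b _ => by ring
    _ = _root_.traceHead φ a := by
        simp only [_root_.traceHead, h1]
        rw [Finset.sum_comm_cycle]
        refine Finset.sum_congr rfl fun p _ => ?_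
        simp only [Finset.mul_sum]

/-- The product of `t` metrics with index pairs placed according to `e`. -/
def matchingTensor {t : ℕ} (e : Fin t × Fin 2 ≃ Fin k) : Tensor d k :=
  fun a => ∏ i, minkowski d (a (e (i, 0))) (a (e (i, 1)))

/-- The span of all products of metrics. -/
def matchingSpan (d k : ℕ) : Submodule ℝ (Tensor d k) :=
  Submodule.span ℝ {φ | ∃ (t : ℕ) (e : Fin t × Fin 2 ≃ Fin k), φ = matchingTensor e}

theorem comp_perm_mem_matchingSpan {φ : Tensor d k} (hφ : φ ∈ matchingSpan d k)
    (σ : Equiv.Perm (Fin k)) : (fun a => φ (a ∘ σ)) ∈ matchingSpan d k := by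
  induction hφ using Submodule.span_induction with
  | mem φ h =>
    obtain ⟨t, e, rfl⟩ := h
    exact Submodule.subset_span ⟨t, e.trans σ, rfl⟩
  | zero => exact Submodule.zero_mem _
  | add φ ψ _ _ h1 h2 => exact Submodule.add_mem _ h1 h2
  | smul c φ _ h => exact Submodule.smul_mem _ c h

theorem matchingSpan_le_evenlySupported : matchingSpan d k ≤ evenlySupported d k := by
  refine Submodule.span_le.2 ?_
  rintro _ ⟨t, e, rfl⟩ a ha p
  have h1 : ∀ i, a (e (i, 0)) = a (e (i, 1)) := by
    intro i
    have := Finset.prod_ne_zero_iff.1 ha i (Finset.mem_univ i)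
    rw [minkowski_apply] at this
    by_contra h
    simp [h] at this
  rw [indexCount, ← e.sum_comp, Fintype.sum_prod_type]
  simp only [Fin.sum_univ_two, h1]
  rw [Finset.sum_add_distrib]
  exact ⟨_, rfl⟩

/-- Extend pairing data by one pair consisting of the first two positions. -/
def extendPairing {t : ℕ} (e : Fin t × Fin 2 ≃ Fin k) : Fin (t + 1) × Fin 2 ≃ Fin (k + 2) where
  toFun x := Fin.cases (motive := fun _ => Fin (k + 2)) (if x.2 = 0 then 0 else 1)
    (fun i => (e (i, x.2)).succ.succ) x.1
  invFun := Fin.cases (0, 0) (Fin.cases (0, 1) fun j => ((e.symm j).1.succ, (e.symm j).2))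
  left_inv := by
    rintro ⟨i, b⟩
    induction i using Fin.cases with
    | zero => fin_cases b <;> rfl
    | succ i => simp
  right_inv := by
    intro j
    induction j using Fin.cases with
    | zero => rfl
    | succ j =>
      induction j using Fin.cases with
      | zero => rfl
      | succ j => simp

theorem metric_mul_mem_matchingSpan {φ : Tensor d k} (hφ : φ ∈ matchingSpan d k) :
    (fun a : Fin (k + 2) → Fin d => minkowski d (a 0) (a 1) * φ (vecTail (vecTail a))) ∈
      matchingSpan d (k + 2) := by
  induction hφ using Submodule.span_induction with
  | mem φ h =>
    obtain ⟨t, e, rfl⟩ := h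
    refine Submodule.subset_span ⟨t + 1, extendPairing e, ?_⟩
    ext a
    simp [matchingTensor, Fin.prod_univ_succ, extendPairing, vecTail]
  | zero =>
    simp only [Pi.zero_apply, mul_zero]
    exact Submodule.zero_mem _
  | add φ ψ _ _ h1 h2 =>
    simp only [Pi.add_apply, mul_add]
    exact Submodule.add_mem _ h1 h2
  | smul c φ _ h =>
    simp only [Pi.smul_apply, smul_eq_mul, mul_left_comm]
    exact Submodule.smul_mem _ c h

theorem IsLorentzInvariant.comp_perm {φ : Tensor d k} (hφ : IsLorentzInvariant φ)
    (σ : Equiv.Perm (Fin k)) : IsLorentzInvariant fun a => φ (a ∘ σ) := by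
  intro g hg
  rw [← permMatrix_mulVec, mulVec_mulVec, ← permMatrix_comm_tensorPower, ← mulVec_mulVec, hφ g hg]

theorem exists_perm_zero_one (i j : Fin (k + 2)) (h : i ≠ j) :
    ∃ π : Equiv.Perm (Fin (k + 2)), π 0 = i ∧ π 1 = j := by
  refine ⟨Equiv.swap 0 i * Equiv.swap 1 (Equiv.swap 0 i j), ?_, ?_⟩
  · have h1 : Equiv.swap 0 i j ≠ 0 := by
      intro h2
      apply h
      have := congrArg (Equiv.swap 0 i) h2
      simpa using this.symm
    rw [Equiv.Perm.mul_apply, Equiv.swap_apply_of_ne_of_ne (by simp) h1.symm,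
      Equiv.swap_apply_left]
  · simp

/-- A permutation moves `i`, `j` to the first two slots; the trace there is an invariant of rank
lower by two, to which `ih` applies. -/
theorem metricTrace_mem_matchingSpan {φ : Tensor d (k + 2)} (hφ : IsLorentzInvariant φ)
    (ih : ∀ ψ : Tensor d k, IsLorentzInvariant ψ → ψ ∈ matchingSpan d k)
    (i j : Fin (k + 2)) (h : i ≠ j) : metricTrace i j φ ∈ matchingSpan d (k + 2) := by
  obtain ⟨π, h0, h1⟩ := exists_perm_zero_one i j h
  have h2 := comp_perm_mem_matchingSpan (metric_mul_mem_matchingSpan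
    (ih _ (hφ.comp_perm π⁻¹).traceHead)) π
  convert h2 using 1
  ext a
  simp only [metricTrace, Function.comp, h0, h1, traceHead]
  congr 1
  refine Finset.sum_congr rfl fun p _ => ?_
  congr 2
  ext l
  obtain ⟨m, rfl⟩ := π.surjective l
  have hm : π⁻¹ (π m) = m := π.symm_apply_apply m
  rw [Function.comp_apply, hm]
  congr 1
  induction m using Fin.cases with
  | zero =>
    rw [h0, Function.update_of_ne h]
    simp
  | succ m =>
    induction m using Fin.cases with
    | zero =>
      have : (Fin.succ 0 : Fin (k + 2)) = 1 := rfl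
      rw [this, h1]
      simp
    | succ m =>
      have hi : π m.succ.succ ≠ i := by
        rw [← h0]
        simp
      have hj : π m.succ.succ ≠ j := by
        rw [← h1, Ne, π.injective.eq_iff, ← Fin.succ_zero_eq_one, Fin.succ_inj]
        simp
      rw [Function.update_of_ne hj, Function.update_of_ne hi]
      simp [vecTail]

/-- The orthogonal Casimir operator. -/
def orthogonalCasimir (d k : ℕ) : Tensor d k →ₗ[ℝ] Tensor d k where
  toFun φ := fun a => (k * d - k : ℝ) * φ a + swapSum φ a
  map_add' φ ψ := by
    ext a
    simp only [swapSum, Pi.add_apply]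
    have : ∀ i j : Fin k, (if i = j then (0 : ℝ) else φ (a ∘ Equiv.swap i j) + ψ (a ∘ Equiv.swap i j))
        = (if i = j then 0 else φ (a ∘ Equiv.swap i j)) +
          if i = j then 0 else ψ (a ∘ Equiv.swap i j) := by
      intro i j
      split_ifs <;> simp
    simp only [this, Finset.sum_add_distrib]
    ring
  map_smul' c φ := by
    ext a
    simp only [swapSum, Pi.smul_apply, smul_eq_mul, RingHom.id_apply, mul_add, Finset.mul_sum,
      mul_ite, mul_zero]
    ring

/-- **First fundamental theorem** for the Lorentz group: invariant tensors are linear combinations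
of products of metrics. -/
theorem IsLorentzInvariant.mem_matchingSpan : ∀ {k : ℕ} {φ : Tensor d k},
    IsLorentzInvariant φ → φ ∈ matchingSpan d k := by
  intro k
  induction k using Nat.strong_induction_on with
  | _ k ih =>
  intro φ hφ
  rcases Nat.eq_zero_or_pos k with rfl | hk
  · have : φ = φ Fin.elim0 • matchingTensor (t := 0)
        ⟨fun x => x.1, fun x => x.elim0, fun x => x.1.elim0, fun x => x.elim0⟩ := by
      ext a
      simp [matchingTensor, Subsingleton.elim a Fin.elim0]
    rw [this]
    exact Submodule.smul_mem _ _ (Submodule.subset_span ⟨0, _, rfl⟩)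
  have hM : orthogonalCasimir d k φ ∈ matchingSpan d k := by
    have h1 : orthogonalCasimir d k φ = ∑ i, ∑ j, if i = j then 0 else metricTrace i j φ := by
      ext a
      simp only [Finset.sum_apply]
      refine (hφ.casimir a).trans ?_
      refine Finset.sum_congr rfl fun i _ => Finset.sum_congr rfl fun j _ => ?_
      split_ifs <;> rfl
    rw [h1]
    refine Submodule.sum_mem _ fun i _ => Submodule.sum_mem _ fun j _ => ?_
    split_ifs with hij
    · exact Submodule.zero_mem _
    · obtain ⟨m, rfl⟩ : ∃ m, k = m + 2 := by
        refine ⟨k - 2, ?_⟩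
        have := i.2
        have := j.2
        have : (i : ℕ) ≠ j := fun h => hij (Fin.ext h)
        omega
      exact metricTrace_mem_matchingSpan hφ (fun ψ hψ => ih m (by omega) hψ) i j hij
  have hstable : ∀ ψ ∈ matchingSpan d k, orthogonalCasimir d k ψ ∈ matchingSpan d k := by
    intro ψ hψ
    have h1 : orthogonalCasimir d k ψ = (k * d - k : ℝ) • ψ +
        ∑ i, ∑ j, if i = j then 0 else fun a => ψ (a ∘ Equiv.swap i j) := by
      ext a
      simp only [Finset.sum_apply, Pi.add_apply, Pi.smul_apply, smul_eq_mul]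
      change _ + swapSum ψ a = _
      congr 1
      refine Finset.sum_congr rfl fun i _ => Finset.sum_congr rfl fun j _ => ?_
      split_ifs <;> rfl
    rw [h1]
    refine Submodule.add_mem _ (Submodule.smul_mem _ _ hψ)
      (Submodule.sum_mem _ fun i _ => Submodule.sum_mem _ fun j _ => ?_)
    split_ifs with hij
    · exact Submodule.zero_mem _
    · exact comp_perm_mem_matchingSpan hψ _
  have hinj : ∀ ψ ∈ _root_.evenlySupported d k, orthogonalCasimir d k ψ = 0 → ψ = 0 :=
    fun ψ hψ h => eq_zero_of_orthogonalCasimir_eq_zero hk ψ hψ fun a => congrFun h a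
  -- An injective operator on the finite-dimensional span of metric products is onto. So the Casimir
  -- image of `φ` is also that of some `ψ` in the span, and injectivity on evenly supported tensors
  -- gives `φ = ψ`.
  let M := (orthogonalCasimir d k).restrict hstable
  have hMi : Function.Injective M := by
    rw [← LinearMap.ker_eq_bot, LinearMap.ker_eq_bot']
    rintro ⟨ψ, hψ⟩ h
    have := hinj ψ (matchingSpan_le_evenlySupported hψ) (congrArg Subtype.val h)
    exact Subtype.ext this
  obtain ⟨⟨ψ, hψ⟩, h⟩ := LinearMap.surjective_of_injective hMi ⟨_, hM⟩
  have h1 : orthogonalCasimir d k ψ = orthogonalCasimir d k φ := congrArg Subtype.val h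
  have h2 := hinj (φ - ψ)
    (Submodule.sub_mem _ hφ.evenlySupported (matchingSpan_le_evenlySupported hψ))
    (by rw [map_sub, h1, sub_self])
  rw [sub_eq_zero.1 h2]
  exact hψ

end LorentzInvariants

/-! ### The first fundamental theorem for the general linear group -/

section GeneralLinear

variable {d k : ℕ}

/-- The operator `T` commutes with the action of all invertible matrices. -/
def IsGLInvariant (T : Matrix (Fin k → Fin d) (Fin k → Fin d) ℝ) : Prop :=
  ∀ g h : Matrix (Fin d) (Fin d) ℝ, g * h = 1 → tensorPower k g * T * tensorPower k h = T

theorem tensorPower_mul_eq_one {g h : Matrix (Fin d) (Fin d) ℝ} (hgh : g * h = 1) :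
    tensorPower k g * tensorPower k h = 1 := by
  rw [← tensorPower_mul, hgh, tensorPower_one]

theorem IsGLInvariant.comm {T : Matrix (Fin k → Fin d) (Fin k → Fin d) ℝ} (hT : IsGLInvariant T)
    {g h : Matrix (Fin d) (Fin d) ℝ} (hgh : g * h = 1) :
    tensorPower k g * T = T * tensorPower k g := by
  have h1 := tensorPower_mul_eq_one (k := k) (mul_eq_one_comm.1 hgh)
  conv_rhs => rw [← hT g h hgh]
  rw [Matrix.mul_assoc _ (tensorPower k h), h1, Matrix.mul_one]

theorem tensorDeriv_transpose (X : Matrix (Fin d) (Fin d) ℝ) :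
    (tensorDeriv k X)ᵀ = tensorDeriv k Xᵀ := by
  ext a b
  simp [tensorDeriv, eq_comm]

theorem tensorDeriv_single_mul (p q : Fin d) (T : Matrix (Fin k → Fin d) (Fin k → Fin d) ℝ)
    (a b : Fin k → Fin d) :
    (tensorDeriv k (Matrix.single p q 1) * T) a b = elemDeriv p q (fun a => T a b) a := by
  have h := congrFun (tensorDeriv_mulVec (Matrix.single p q 1) (fun a => T a b)) a
  refine Eq.trans h ?_
  refine Finset.sum_congr rfl fun i _ => ?_
  by_cases hi : a i = p
  · simp [hi, Matrix.single_apply]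
  · simp [hi, Ne.symm hi]

/-- `1 + t • X` is invertible for `t` near 0, so commutation may be differentiated along this line.
-/
theorem IsGLInvariant.tensorDeriv_comm {T : Matrix (Fin k → Fin d) (Fin k → Fin d) ℝ}
    (hT : IsGLInvariant T) (X : Matrix (Fin d) (Fin d) ℝ) :
    tensorDeriv k X * T = T * tensorDeriv k X := by
  ext a b
  have hX : ∀ p q, HasDerivAt (fun t : ℝ => (1 + t • X) p q) (X p q) 0 := by
    intro p q
    have := ((hasDerivAt_id (0 : ℝ)).mul_const (X p q)).const_add
      ((1 : Matrix (Fin d) (Fin d) ℝ) p q)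
    simpa using this
  have h1 : HasDerivAt (fun t : ℝ => (tensorPower k ((1 : Matrix (Fin d) (Fin d) ℝ) + t • X) * T) a b)
      ((tensorDeriv k X * T) a b) 0 := by
    simp only [mul_apply]
    exact HasDerivAt.fun_sum fun c _ =>
      (hasDerivAt_tensorPower _ X (by simp) hX a c).mul_const _
  have h2 : HasDerivAt (fun t : ℝ => (T * tensorPower k ((1 : Matrix (Fin d) (Fin d) ℝ) + t • X)) a b)
      ((T * tensorDeriv k X) a b) 0 := by
    simp only [mul_apply]
    exact HasDerivAt.fun_sum fun c _ =>
      (hasDerivAt_tensorPower _ X (by simp) hX c b).const_mul _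
  have hdet : ∀ᶠ t : ℝ in nhds 0, (1 + t • X).det ≠ 0 := by
    have hc : Continuous fun t : ℝ => (1 + t • X).det := by fun_prop
    refine hc.continuousAt.eventually_ne ?_
    simp
  refine h1.unique (h2.congr_of_eventuallyEq ?_)
  filter_upwards [hdet] with t ht
  rw [hT.comm (Matrix.mul_nonsing_inv _ (isUnit_iff_ne_zero.2 ht))]

/-- Infinitesimal commutation moves a derivation from the row index to its transpose on the column
index. -/
theorem IsGLInvariant.elemDeriv_eq {T : Matrix (Fin k → Fin d) (Fin k → Fin d) ℝ}
    (hT : IsGLInvariant T) (p q : Fin d) (a b : Fin k → Fin d) :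
    elemDeriv p q (fun a => T a b) a = elemDeriv q p (fun b => T a b) b := by
  have h1 := congrFun (congrFun (hT.tensorDeriv_comm (Matrix.single p q 1)) a) b
  rw [tensorDeriv_single_mul] at h1
  rw [h1, ← transpose_apply (T * _), transpose_mul, tensorDeriv_transpose,
    Matrix.transpose_single, tensorDeriv_single_mul]
  rfl

/-- The Kronecker delta of the indices `i`, `j` times the contraction of `T` over these indices. -/
def deltaTrace (i j : Fin k) (T : Matrix (Fin k → Fin d) (Fin k → Fin d) ℝ) :
    Matrix (Fin k → Fin d) (Fin k → Fin d) ℝ :=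
  Matrix.of fun a b => if a i = b j then
    ∑ p, T (Function.update a i p) (Function.update b j p) else 0

/-- Once the inner derivation is moved to the column index, the two derivations act on different
arguments, so each pair of slots contributes a contraction of a row index with a column index. -/
theorem IsGLInvariant.casimir {T : Matrix (Fin k → Fin d) (Fin k → Fin d) ℝ}
    (hT : IsGLInvariant T) (a b : Fin k → Fin d) :
    (k * d : ℝ) * T a b + swapSum (fun a => T a b) a = ∑ i, ∑ j, deltaTrace i j T a b := by
  rw [← sum_elemDeriv_elemDeriv (fun a => T a b) a]
  have h2 : ∀ p q, elemDeriv p q (fun a => T a b) =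
      fun a => elemDeriv q p (fun b => T a b) b :=
    fun p q => funext fun a => hT.elemDeriv_eq p q a b
  rw [show (fun p => ∑ q, elemDeriv q p (elemDeriv p q (fun a => T a b)) a) = fun p =>
    ∑ q, elemDeriv q p (fun a => elemDeriv q p (fun b => T a b) b) a from
    funext fun p => Finset.sum_congr rfl fun q _ => by rw [h2 p q],
    sum_elemDeriv_comp (fun p q a => elemDeriv q p (fun b => T a b) b), Finset.sum_comm]
  refine Finset.sum_congr rfl fun i _ => ?_
  simp only [elemDeriv, deltaTrace, of_apply]
  rw [Finset.sum_comm]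
  refine Finset.sum_congr rfl fun j _ => ?_
  by_cases h : a i = b j
  · simp [h]
  · simp [h, Ne.symm h]

/-- The contraction over the first index of each argument. -/
def contractHead (T : Matrix (Fin (k + 1) → Fin d) (Fin (k + 1) → Fin d) ℝ) :
    Matrix (Fin k → Fin d) (Fin k → Fin d) ℝ :=
  Matrix.of fun a b => ∑ p, T (vecCons p a) (vecCons p b)

theorem IsGLInvariant.contractHead {T : Matrix (Fin (k + 1) → Fin d) (Fin (k + 1) → Fin d) ℝ}
    (hT : IsGLInvariant T) : IsGLInvariant (contractHead T) := by
  intro g h hgh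
  ext a b
  have hhg : ∀ x y, ∑ p, g p x * h y p = if y = x then 1 else 0 := by
    intro x y
    have h0 : h * g = 1 := mul_eq_one_comm.1 hgh
    have := congrFun (congrFun h0 y) x
    rw [mul_apply, one_apply] at this
    rw [← this]
    exact Finset.sum_congr rfl fun p _ => mul_comm _ _
  have h1 : ∀ p, T (vecCons p a) (vecCons p b) = ∑ x, ∑ y, ∑ a', ∑ b',
      (g p x * h y p) *
        (tensorPower k g a a' * T (vecCons x a') (vecCons y b') * tensorPower k h b' b) := by
    intro p
    conv_lhs => rw [← hT g h hgh]
    simp only [mul_apply, Finset.sum_mul]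
    rw [Finset.sum_comm, sum_vecCons]
    refine Finset.sum_congr rfl fun x _ => ?_
    simp only [sum_vecCons (k := k), tensorPower_vecCons]
    rw [Finset.sum_comm]
    refine Finset.sum_congr rfl fun y _ => ?_
    refine Finset.sum_congr rfl fun a' _ => ?_
    refine Finset.sum_congr rfl fun b' _ => ?_
    ring
  have h2 : _root_.contractHead T a b = ∑ x, ∑ y, ∑ a', ∑ b', (∑ p, g p x * h y p) *
        (tensorPower k g a a' * T (vecCons x a') (vecCons y b') * tensorPower k h b' b) := by
    simp only [_root_.contractHead, of_apply, h1, Finset.sum_mul]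
    rw [Finset.sum_comm]
    refine Finset.sum_congr rfl fun x _ => ?_
    rw [Finset.sum_comm]
    refine Finset.sum_congr rfl fun y _ => ?_
    rw [Finset.sum_comm]
    refine Finset.sum_congr rfl fun a' _ => ?_
    rw [Finset.sum_comm]
  rw [h2]
  simp only [hhg, ite_mul, one_mul, zero_mul]
  simp only [mul_apply, Finset.sum_mul, _root_.contractHead, of_apply, Finset.mul_sum]
  rw [Finset.sum_comm_cycle]
  refine Finset.sum_congr rfl fun x _ => ?_
  rw [Finset.sum_comm]
  rw [Finset.sum_eq_single x (fun y _ hy => by simp [hy]) (by simp)]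
  simp

theorem permMatrix_mul_mem_permSpan {T : Matrix (Fin k → Fin d) (Fin k → Fin d) ℝ}
    {p : Equiv.Perm (Fin k) → Prop} (hp : ∀ σ τ, p σ → p τ → p (σ * τ))
    (hT : T ∈ permSpan d k p) {σ : Equiv.Perm (Fin k)} (hσ : p σ) :
    permMatrix d σ * T ∈ permSpan d k p := by
  induction hT using Submodule.span_induction with
  | mem T h =>
    obtain ⟨τ, hτ, rfl⟩ := h
    exact Submodule.subset_span ⟨σ * τ, hp _ _ hσ hτ, (permMatrix_mul _ _).symm⟩
  | zero => simp
  | add S T _ _ h1 h2 => rw [Matrix.mul_add]; exact Submodule.add_mem _ h1 h2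
  | smul c T _ h => rw [Matrix.mul_smul]; exact Submodule.smul_mem _ c h

theorem mul_mem_permSpan {S T : Matrix (Fin k → Fin d) (Fin k → Fin d) ℝ}
    {p : Equiv.Perm (Fin k) → Prop} (hp : ∀ σ τ, p σ → p τ → p (σ * τ))
    (hS : S ∈ permSpan d k p) (hT : T ∈ permSpan d k p) : S * T ∈ permSpan d k p := by
  induction hS using Submodule.span_induction with
  | mem S h =>
    obtain ⟨σ, hσ, rfl⟩ := h
    exact permMatrix_mul_mem_permSpan hp hT hσ
  | zero => simp
  | add S T _ _ h1 h2 => rw [Matrix.add_mul]; exact Submodule.add_mem _ h1 h2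
  | smul c T _ h => rw [Matrix.smul_mul]; exact Submodule.smul_mem _ c h

theorem permMatrix_mem (σ : Equiv.Perm (Fin k)) : permMatrix d σ ∈ permSpan d k fun _ => True :=
  Submodule.subset_span ⟨σ, trivial, rfl⟩

theorem delta_mul_mem_permSpan {T : Matrix (Fin k → Fin d) (Fin k → Fin d) ℝ}
    (hT : T ∈ permSpan d k fun _ => True) :
    (Matrix.of fun a b : Fin (k + 1) → Fin d =>
      if a 0 = b 0 then T (vecTail a) (vecTail b) else 0) ∈ permSpan d (k + 1) fun _ => True := by
  induction hT using Submodule.span_induction with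
  | mem T h =>
    obtain ⟨σ, -, rfl⟩ := h
    -- This permutation fixes 0 and acts as `σ` on the successors.
    refine Submodule.subset_span ⟨Equiv.Perm.decomposeFin.symm (0, σ), trivial, ?_⟩
    ext a b
    simp only [permMatrix, of_apply, ← ite_and]
    congr 1
    apply propext
    rw [funext_iff, funext_iff, Fin.forall_fin_succ]
    simp [vecTail]
  | zero => 
    convert Submodule.zero_mem _ using 1
    ext a b
    simp
  | add S T _ _ h1 h2 =>
    convert Submodule.add_mem _ h1 h2 using 1
    ext a b
    simp only [of_apply, Matrix.add_apply]
    split_ifs <;> simp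
  | smul c T _ h =>
    convert Submodule.smul_mem _ c h using 1
    ext a b
    simp

theorem vecCons_vecTail_comp_swap (a : Fin (k + 1) → Fin d) (i : Fin (k + 1)) (p : Fin d) :
    vecCons p (vecTail (a ∘ Equiv.swap 0 i)) ∘ Equiv.swap 0 i = Function.update a i p := by
  ext l
  obtain ⟨m, rfl⟩ := (Equiv.swap 0 i).surjective l
  rw [Function.comp_apply, Equiv.swap_apply_self]
  congr 1
  induction m using Fin.cases with
  | zero => simp
  | succ m =>
    have : Equiv.swap 0 i m.succ ≠ i := by
      intro h
      have := congrArg (Equiv.swap 0 i) h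
      simp at this
    rw [Function.update_of_ne this]
    simp [vecTail]

theorem IsGLInvariant.permMatrix_mul {T : Matrix (Fin k → Fin d) (Fin k → Fin d) ℝ}
    (hT : IsGLInvariant T) (σ τ : Equiv.Perm (Fin k)) :
    IsGLInvariant (permMatrix d σ * T * permMatrix d τ) := by
  intro g h hgh
  calc _ = tensorPower k g * permMatrix d σ * T * (permMatrix d τ * tensorPower k h) := by
        simp only [Matrix.mul_assoc]
    _ = permMatrix d σ * (tensorPower k g * T * tensorPower k h) * permMatrix d τ := by
        rw [← permMatrix_comm_tensorPower, permMatrix_comm_tensorPower τ]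
        simp only [Matrix.mul_assoc]
    _ = _ := by rw [hT g h hgh]

theorem deltaTrace_mem_permSpan {T : Matrix (Fin (k + 1) → Fin d) (Fin (k + 1) → Fin d) ℝ}
    (hT : IsGLInvariant T)
    (ih : ∀ S : Matrix (Fin k → Fin d) (Fin k → Fin d) ℝ, IsGLInvariant S →
      S ∈ permSpan d k fun _ => True) (i j : Fin (k + 1)) :
    deltaTrace i j T ∈ permSpan d (k + 1) fun _ => True := by
  have h1 := delta_mul_mem_permSpan (ih _ (hT.permMatrix_mul (Equiv.swap 0 i)
    (Equiv.swap 0 j)).contractHead)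
  have h2 := mul_mem_permSpan (fun _ _ _ _ => trivial)
    (mul_mem_permSpan (fun _ _ _ _ => trivial) (permMatrix_mem (Equiv.swap 0 i)) h1)
    (permMatrix_mem (Equiv.swap 0 j))
  convert h2 using 1
  ext a b
  rw [mul_permMatrix_apply, permMatrix_mul_apply]
  simp only [deltaTrace, of_apply, contractHead, mul_permMatrix_apply, permMatrix_mul_apply,
    Equiv.swap_inv, vecCons_vecTail_comp_swap]
  simp

/-- **Schur–Weyl duality**: an operator that commutes with the general linear group is a linear
combination of index permutations. -/
theorem IsGLInvariant.mem_permSpan {T : Matrix (Fin k → Fin d) (Fin k → Fin d) ℝ}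
    (hT : IsGLInvariant T) : T ∈ permSpan d k fun _ => True := by
  induction k with
  | zero =>
    have : T = T Fin.elim0 Fin.elim0 • permMatrix d 1 := by
      ext a b
      rw [Subsingleton.elim a Fin.elim0, Subsingleton.elim b Fin.elim0]
      simp [permMatrix_one]
    rw [this]
    exact Submodule.smul_mem _ _ (permMatrix_mem 1)
  | succ k ih =>
    let M : Matrix (Fin (k + 1) → Fin d) (Fin (k + 1) → Fin d) ℝ →ₗ[ℝ]
        Matrix (Fin (k + 1) → Fin d) (Fin (k + 1) → Fin d) ℝ :=
      LinearMap.mulLeft ℝ (((k + 1 : ℕ) * d : ℝ) • (1 : Matrix _ _ ℝ) +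
        ∑ i, ∑ j, if i = j then 0 else permMatrix d (Equiv.swap i j))
    have hMa : ∀ S a b, M S a b = ((k + 1 : ℕ) * d : ℝ) * S a b + swapSum (fun a => S a b) a := by
      intro S a b
      simp only [M, LinearMap.mulLeft_apply, Matrix.add_mul, Matrix.smul_mul, Matrix.one_mul,
        Matrix.sum_mul, Matrix.add_apply, Matrix.smul_apply, smul_eq_mul, Matrix.sum_apply,
        swapSum]
      congr 1
      refine Finset.sum_congr rfl fun i _ => Finset.sum_congr rfl fun j _ => ?_
      split_ifs
      · simp
      · rw [permMatrix_mul_apply]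
    have hstable : ∀ S ∈ permSpan d (k + 1) fun _ => True,
        M S ∈ permSpan d (k + 1) fun _ => True := by
      intro S hS
      refine mul_mem_permSpan (fun _ _ _ _ => trivial) (Submodule.add_mem _ ?_
        (Submodule.sum_mem _ fun i _ => Submodule.sum_mem _ fun j _ => ?_)) hS
      · rw [← permMatrix_one]
        exact Submodule.smul_mem _ _ (permMatrix_mem 1)
      · split_ifs
        · exact Submodule.zero_mem _
        · exact permMatrix_mem _
    have hinj : ∀ S, M S = 0 → S = 0 := by
      intro S hS
      ext a b
      have := eq_zero_of_casimir_eq_zero (Nat.succ_pos k) (fun a => S a b)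
        fun a => by rw [← hMa, hS]; rfl
      exact congrFun this a
    have hMT : M T ∈ permSpan d (k + 1) fun _ => True := by
      have : M T = ∑ i, ∑ j, deltaTrace i j T := by
        ext a b
        rw [hMa, hT.casimir]
        simp only [Matrix.sum_apply]
      rw [this]
      exact Submodule.sum_mem _ fun i _ => Submodule.sum_mem _ fun j _ =>
        deltaTrace_mem_permSpan hT (fun S hS => ih hS) i j
    -- As for the Lorentz group: `M` is injective on all operators, hence bijective on the
    -- finite-dimensional span of permutations, which contains `M T`.
    have hMi : Function.Injective (M.restrict hstable) := by
      rw [← LinearMap.ker_eq_bot, LinearMap.ker_eq_bot']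
      rintro ⟨S, hS⟩ h
      exact Subtype.ext (hinj S (congrArg Subtype.val h))
    obtain ⟨⟨S, hS⟩, h⟩ := LinearMap.surjective_of_injective hMi ⟨_, hMT⟩
    have h1 : M S = M T := congrArg Subtype.val h
    have h2 := hinj (T - S) (by rw [map_sub, h1, sub_self])
    rw [sub_eq_zero.1 h2]
    exact hS

end GeneralLinear

/-! ### Brauer diagrams as partially transposed permutations -/

/-- The involutions generate a dihedral group: `μ zⁿ = z⁻ⁿ μ` for `z = τμ`. If `zⁿ x = μ x`, then
`μ` fixes `zʲ x` when `n = 2j`, and `τ` fixes `zʲ⁺¹ x` when `n = 2j + 1`. -/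
theorem not_sameCycle_mul {X : Type*} {μ τ : Equiv.Perm X} (hμ : ∀ x, μ (μ x) = x)
    (hτ : ∀ x, τ (τ x) = x) (hμ' : ∀ x, μ x ≠ x) (hτ' : ∀ x, τ x ≠ x) (x : X) :
    ¬ (τ * μ).SameCycle x (μ x) := by
  have hμμ : μ * μ = 1 := Equiv.ext hμ
  have hττ : τ * τ = 1 := Equiv.ext hτ
  have hμi : μ⁻¹ = μ := inv_eq_of_mul_eq_one_left hμμ
  have hτi : τ⁻¹ = τ := inv_eq_of_mul_eq_one_left hττ
  set z := τ * μ with hz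
  have hconj : ∀ n : ℤ, μ * z ^ n = z ^ (-n) * μ := by
    intro n
    have h1 : μ * z * μ⁻¹ = z⁻¹ := by
      rw [hz, _root_.mul_inv_rev, hμi, hτi, mul_assoc, mul_assoc, hμμ, mul_one]
    have h2 : μ * z ^ n * μ⁻¹ = z ^ (-n) := by
      rw [← conj_zpow, h1, _root_.inv_zpow, _root_.zpow_neg]
    rw [← h2, inv_mul_cancel_right]
  rintro ⟨n, hn⟩
  rcases Int.even_or_odd' n with ⟨j, rfl | rfl⟩
  · apply hμ' ((z ^ j) x)
    rw [← Equiv.Perm.mul_apply, hconj, Equiv.Perm.mul_apply, ← hn, ← Equiv.Perm.mul_apply,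
      ← _root_.zpow_add]
    congr 2
    ring
  · apply hτ' ((z ^ (j + 1)) x)
    have h3 : τ = z * μ := by rw [hz, mul_assoc, hμμ, mul_one]
    conv_lhs => rw [h3]
    have h4 : z * μ * z ^ (j + 1) = z ^ (-j) * μ := by
      rw [mul_assoc, hconj, ← mul_assoc, ← _root_.zpow_one_add]
      congr 2
      ring
    rw [← Equiv.Perm.mul_apply, h4, Equiv.Perm.mul_apply, ← hn, ← Equiv.Perm.mul_apply,
      ← _root_.zpow_add]
    congr 2
    ring

/-- The union of two perfect matchings has a proper two-colouring. -/
theorem exists_coloring {X : Type*} [Finite X] (μ τ : Equiv.Perm X) (hμ : ∀ x, μ (μ x) = x)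
    (hτ : ∀ x, τ (τ x) = x) (hμ' : ∀ x, μ x ≠ x) (hτ' : ∀ x, τ x ≠ x) :
    ∃ c : X → Bool, (∀ x, c (μ x) = !c x) ∧ ∀ x, c (τ x) = !c x := by
  classical
  obtain ⟨f, hf⟩ := exists_injective_nat (Quotient (Equiv.Perm.SameCycle.setoid (τ * μ)))
  -- `m` labels the cycles of `τ * μ` injectively. Both `μ` and `τ` pass from the cycle of `x` to
  -- the same other cycle, so comparing the two labels gives a colour that both flip.
  let m : X → ℕ := fun x => f (Quotient.mk _ x)
  have hm : ∀ x y, m x = m y ↔ (τ * μ).SameCycle x y := fun x y => by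
    rw [hf.eq_iff, Quotient.eq]
    rfl
  have h1 : ∀ x, m (μ x) ≠ m x := fun x h =>
    not_sameCycle_mul hμ hτ hμ' hτ' x ((hm _ _).1 h.symm)
  have h2 : ∀ x, m (τ x) = m (μ x) := fun x => by
    rw [hm, Equiv.Perm.sameCycle_comm]
    exact ⟨1, by simp [hμ]⟩
  have h3 : ∀ x, m (μ (τ x)) = m x := fun x => by
    rw [hm]
    exact ⟨1, by simp [hμ, hτ]⟩
  have h4 : ∀ a b : ℕ, a ≠ b → decide (a < b) = !decide (b < a) := by
    intro a b hab
    rw [Bool.eq_iff_iff]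
    simp
    omega
  refine ⟨fun x => decide (m x < m (μ x)), fun x => ?_, fun x => ?_⟩
  · simp only [hμ]
    exact h4 _ _ (h1 x)
  · simp only [h2, h3]
    exact h4 _ _ (h1 x)

/-! ### The Lorentz commutant and symmetry of averaged Brauer diagrams. -/

section Brauer

variable {d r : ℕ}

/-- The Brauer diagram obtained from the permutation `g` by partial transposition at the positions
where `ε` is false, as an operator with all indices raised. -/
def brauerMatrix (d : ℕ) {r : ℕ} (g : Equiv.Perm (Fin r)) (ε : Fin r → Bool) :
    Matrix (Fin r → Fin d) (Fin r → Fin d) ℝ :=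
  Matrix.of fun a b => ∏ i, minkowski d (cond (ε i) (a i) (b i))
    (cond (ε (g i)) (b (g i)) (a (g i)))

/-- Each position and each edge has exactly one vertex of colour true, so matching positions with
edges through these vertices is a bijection. -/
theorem exists_edge_equiv {t : ℕ} (e : Fin t × Fin 2 ≃ Fin r ⊕ Fin r) (c : Fin r ⊕ Fin r → Bool)
    (h1 : ∀ i, c (Sum.inr i) = !c (Sum.inl i)) (h2 : ∀ k, c (e (k, 1)) = !c (e (k, 0))) :
    ∃ κ : Fin r ≃ Fin t, ∀ i, cond (c (e (κ i, 0))) (e (κ i, 0)) (e (κ i, 1)) =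
      cond (c (Sum.inl i)) (Sum.inl i) (Sum.inr i) := by
  let x : Fin r → Fin r ⊕ Fin r := fun i => cond (c (Sum.inl i)) (Sum.inl i) (Sum.inr i)
  let y : Fin t → Fin r ⊕ Fin r := fun k => cond (c (e (k, 0))) (e (k, 0)) (e (k, 1))
  have hx : ∀ i, c (x i) = true := by
    intro i
    simp only [x]
    cases h : c (Sum.inl i)
    · simp [h1, h]
    · simp [h]
  have hx2 : ∀ w, c w = true → ∃ i, x i = w := by
    rintro (i | i) h
    · exact ⟨i, by simp [x, h]⟩
    · rw [h1] at h
      exact ⟨i, by simp at h; simp [x, h]⟩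
  have hx3 : Function.Injective x := by
    intro i j h
    simp only [x] at h
    cases hi : c (Sum.inl i) <;> cases hj : c (Sum.inl j) <;> simp_all
  have hy : ∀ k, c (y k) = true := by
    intro k
    simp only [y]
    cases h : c (e (k, 0))
    · simp [h2, h]
    · simp [h]
  have hy2 : ∀ w, c w = true → y (e.symm w).1 = w := by
    intro w hw
    obtain ⟨⟨k, b⟩, rfl⟩ := e.surjective w
    simp only [Equiv.symm_apply_apply, y]
    fin_cases b
    · simp at hw
      simp [hw]
    · simp only [Fin.mk_one, Fin.isValue] at hw
      have : c (e (k, 0)) = false := by simpa [h2] using hw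
      simp [this]
  have hy3 : ∀ k, (e.symm (y k)).1 = k := by
    intro k
    simp only [y]
    cases c (e (k, 0)) <;> simp
  refine ⟨Equiv.ofBijective (fun i => (e.symm (x i)).1) ⟨?_, ?_⟩, fun i => hy2 _ (hx i)⟩
  · intro i j hij
    apply hx3
    rw [← hy2 _ (hx i), ← hy2 _ (hx j)]
    exact congrArg y hij
  · intro k
    obtain ⟨i, hi⟩ := hx2 _ (hy k)
    exact ⟨i, by simp only [hi, hy3]⟩

/-- Colour the `2r` vertices so that edge partners, and also the two vertices over one position,
differ. Orient each edge from true to false: the edge leaving the true vertex over `i` ends at the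
false vertex over `g i`, and `ε` records whether the upper vertex is the true one. -/
theorem exists_brauerMatrix_eq {t : ℕ} (e : Fin t × Fin 2 ≃ Fin r ⊕ Fin r) :
    ∃ (g : Equiv.Perm (Fin r)) (ε : Fin r → Bool), ∀ a b : Fin r → Fin d,
      ∏ k, minkowski d (Sum.elim a b (e (k, 0))) (Sum.elim a b (e (k, 1))) =
        brauerMatrix d g ε a b := by
  have hr : ∀ i : Fin 2, Fin.rev i ≠ i := by decide
  obtain ⟨c, h1, h2⟩ := exists_coloring (X := Fin r ⊕ Fin r)
    ((e.symm.trans ((Equiv.refl _).prodCongr Fin.revPerm)).trans e) (Equiv.sumComm _ _)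
    (fun x => by
      obtain ⟨⟨k, i⟩, rfl⟩ := e.surjective x
      simp) (by simp) (fun x h => by
      obtain ⟨⟨k, i⟩, rfl⟩ := e.surjective x
      simp [hr] at h) (by rintro (i | i) <;> simp)
  have h1' : ∀ k, c (e (k, 1)) = !c (e (k, 0)) := fun k => by
    simpa using h1 (e (k, 0))
  have h2' : ∀ i, c (Sum.inr i) = !c (Sum.inl i) := fun i => h2 (Sum.inl i)
  obtain ⟨κ, hκ⟩ := exists_edge_equiv e c h2' h1'
  obtain ⟨l, hl⟩ := exists_edge_equiv e (fun x => !c x) (by simp [h2']) (by simp [h1'])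
  refine ⟨κ.trans l.symm, fun i => c (Sum.inl i), fun a b => ?_⟩
  rw [brauerMatrix, of_apply, ← κ.prod_comp]
  refine Finset.prod_congr rfl fun i _ => ?_
  have e1 := congrArg (Sum.elim a b) (hκ i)
  have e2 := congrArg (Sum.elim a b) (hl (l.symm (κ i)))
  rw [l.apply_symm_apply] at e2
  simp only [Bool.apply_cond (Sum.elim a b), Bool.cond_not, Sum.elim_inl, Sum.elim_inr]
    at e1 e2
  rw [Equiv.trans_apply, ← e1, ← e2]
  cases c (e (κ i, 0))
  · exact minkowski_symm _ _
  · rfl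

/-- The span of all Brauer diagrams. -/
def brauerSpan (d r : ℕ) : Submodule ℝ (Matrix (Fin r → Fin d) (Fin r → Fin d) ℝ) :=
  Submodule.span ℝ {M | ∃ g ε, M = brauerMatrix d g ε}

theorem IsLorentz.mul_minkowski_mul {g : Matrix (Fin d) (Fin d) ℝ} (hg : IsLorentz g) :
    g * minkowski d * gᵀ = minkowski d := by
  have h1 : (minkowski d * gᵀ * minkowski d) * g = 1 := by
    rw [Matrix.mul_assoc, Matrix.mul_assoc, ← Matrix.mul_assoc gᵀ, hg, minkowski_mul_self]
  have h2 : g * (minkowski d * gᵀ * minkowski d) = 1 := mul_eq_one_comm.1 h1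
  calc g * minkowski d * gᵀ = g * (minkowski d * gᵀ * minkowski d) * minkowski d := by
        simp only [Matrix.mul_assoc, minkowski_mul_self, Matrix.mul_one]
    _ = minkowski d := by rw [h2, Matrix.one_mul]

/-- Because `η² = 1`, a left inverse built from `gᵀ` is also a right inverse. Closure under
transposition is what makes Euclidean complements Lorentz-invariant. -/
theorem IsLorentz.transpose {g : Matrix (Fin d) (Fin d) ℝ} (hg : IsLorentz g) :
    IsLorentz gᵀ := by
  rw [IsLorentz, transpose_transpose]
  exact hg.mul_minkowski_mul

/-- The operator `T` commutes with the Lorentz group. -/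
def IsLorentzEquivariant (T : Matrix (Fin r → Fin d) (Fin r → Fin d) ℝ) : Prop :=
  ∀ g : Matrix (Fin d) (Fin d) ℝ, IsLorentz g → tensorPower r g * T = T * tensorPower r g

/-- **First fundamental theorem** for the Lorentz group, in the form of a description of the
commutant: it is spanned by Brauer diagrams. -/
theorem IsLorentzEquivariant.mem_brauerSpan {T : Matrix (Fin r → Fin d) (Fin r → Fin d) ℝ}
    (hT : IsLorentzEquivariant T) : T * tensorPower r (minkowski d) ∈ brauerSpan d r := by
  set S := T * tensorPower r (minkowski d) with hS
  have hSg : ∀ g, IsLorentz g → tensorPower r g * S * (tensorPower r g)ᵀ = S := by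
    intro g hg
    rw [hS, ← Matrix.mul_assoc, hT g hg, Matrix.mul_assoc, Matrix.mul_assoc,
      ← tensorPower_transpose, ← tensorPower_mul, ← tensorPower_mul, ← Matrix.mul_assoc,
      hg.mul_minkowski_mul]
  -- With the column indices raised, equivariance of `T` becomes invariance of a tensor of rank
  -- `2r`.
  let φ : Tensor d (r + r) := fun c => S (fun i => c (Fin.castAdd r i)) fun i => c (Fin.natAdd r i)
  have hφ : IsLorentzInvariant φ := by
    intro g hg
    ext c
    conv_rhs => simp only [φ]; rw [← hSg g hg]
    simp only [mulVec, dotProduct]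
    rw [← (Fin.appendEquiv r r).sum_comp, Fintype.sum_prod_type, Finset.sum_comm]
    simp only [mul_apply, Finset.sum_mul]
    refine Finset.sum_congr rfl fun b _ => Finset.sum_congr rfl fun a _ => ?_
    simp only [Fin.appendEquiv, Equiv.coe_fn_mk, tensorPower, of_apply, Fin.prod_univ_add,
      Fin.append_left, Fin.append_right, transpose_apply, φ]
    ring
  have hSφ : S = Matrix.of fun a b => φ (Fin.append a b) := by
    ext a b
    simp only [φ, of_apply, Fin.append_left, Fin.append_right]
  rw [hSφ]
  have h := hφ.mem_matchingSpan
  clear_value φ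
  clear hSφ hφ
  induction h using Submodule.span_induction with
  | mem φ h =>
    obtain ⟨t, e, rfl⟩ := h
    obtain ⟨g, ε, h⟩ := exists_brauerMatrix_eq (d := d) (e.trans finSumFinEquiv.symm)
    refine Submodule.subset_span ⟨g, ε, ?_⟩
    ext a b
    have h0 : ∀ x, Fin.append a b x = Sum.elim a b (finSumFinEquiv.symm x) := by
      intro x
      obtain ⟨y, rfl⟩ := finSumFinEquiv.surjective x
      rw [Equiv.symm_apply_apply]
      rcases y with y | y
      · rw [finSumFinEquiv_apply_left, Fin.append_left, Sum.elim_inl]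
      · rw [finSumFinEquiv_apply_right, Fin.append_right, Sum.elim_inr]
    rw [← h]
    simp only [of_apply, matchingTensor, h0, Equiv.trans_apply]
  | zero => exact Submodule.zero_mem _
  | add φ ψ _ _ h1 h2 => exact Submodule.add_mem _ h1 h2
  | smul c φ _ h => exact Submodule.smul_mem _ c h

theorem brauerMatrix_transpose (g : Equiv.Perm (Fin r)) (ε : Fin r → Bool) :
    (brauerMatrix d g ε)ᵀ = brauerMatrix d g⁻¹ ε := by
  ext a b
  simp only [brauerMatrix, transpose_apply, of_apply]
  rw [← Equiv.prod_comp g⁻¹]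
  refine Finset.prod_congr rfl fun i _ => ?_
  rw [minkowski_symm]
  simp

theorem permMatrix_conj_brauerMatrix (k g : Equiv.Perm (Fin r)) (ε : Fin r → Bool)
    (hε : ∀ i, ε (k i) = ε i) :
    permMatrix d k * brauerMatrix d g ε * (permMatrix d k)ᵀ = brauerMatrix d (k * g * k⁻¹) ε := by
  ext a b
  rw [permMatrix_transpose, mul_permMatrix_apply, permMatrix_mul_apply, inv_inv]
  simp only [brauerMatrix, of_apply]
  refine Fintype.prod_equiv k _ _ fun i => ?_
  have hi : k⁻¹ (k i) = i := k.symm_apply_apply i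
  simp only [Function.comp_apply, Equiv.Perm.mul_apply, hi, hε]

/-- Averaging over conjugation by index permutations. -/
noncomputable def permAverage (H : Subgroup (Equiv.Perm (Fin r)))
    (M : Matrix (Fin r → Fin d) (Fin r → Fin d) ℝ) : Matrix (Fin r → Fin d) (Fin r → Fin d) ℝ :=
  open Classical in ∑ k : H, permMatrix d k.1 * M * (permMatrix d k.1)ᵀ

theorem permAverage_transpose (H : Subgroup (Equiv.Perm (Fin r)))
    (M : Matrix (Fin r → Fin d) (Fin r → Fin d) ℝ) :
    (permAverage H M)ᵀ = permAverage H Mᵀ := by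
  simp only [permAverage, transpose_sum, transpose_mul, transpose_transpose, Matrix.mul_assoc]

theorem permAverage_conj (H : Subgroup (Equiv.Perm (Fin r)))
    (M : Matrix (Fin r → Fin d) (Fin r → Fin d) ℝ) {k : Equiv.Perm (Fin r)} (hk : k ∈ H) :
    permAverage H (permMatrix d k * M * (permMatrix d k)ᵀ) = permAverage H M := by
  classical
  simp only [permAverage]
  refine Fintype.sum_equiv (Equiv.mulRight (⟨k, hk⟩ : H)) _ _ fun x => ?_
  simp [_root_.permMatrix_mul, transpose_mul, Matrix.mul_assoc]

/-- The operators whose averages over `H` are symmetric. -/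
def symmAverage (d : ℕ) {r : ℕ} (H : Subgroup (Equiv.Perm (Fin r))) :
    Submodule ℝ (Matrix (Fin r → Fin d) (Fin r → Fin d) ℝ) where
  carrier := {M | (permAverage H M)ᵀ = permAverage H M}
  zero_mem' := by simp [permAverage]
  add_mem' := by
    intro M N hM hN
    simp only [Set.mem_ofPred_eq, permAverage, Matrix.mul_add, Matrix.add_mul,
      Finset.sum_add_distrib, transpose_add] at *
    rw [hM, hN]
  smul_mem' := by
    intro c M hM
    simp only [Set.mem_ofPred_eq, permAverage, Matrix.mul_smul, Matrix.smul_mul,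
      ← Finset.smul_sum, transpose_smul] at *
    rw [hM]

/-- Transposing a diagram inverts `g` and keeps `ε`. A colour-preserving `k` conjugates `g` to
`g⁻¹`, and averaging does not see conjugation. -/
theorem brauerSpan_le_symmAverage (hr : r ≤ 5) : brauerSpan d r ≤ symmAverage d ⊤ := by
  refine Submodule.span_le.2 ?_
  rintro _ ⟨g, ε, rfl⟩
  obtain ⟨k, hk, hε, -⟩ := exists_reversing hr g ε
  change (permAverage ⊤ _)ᵀ = permAverage ⊤ _
  rw [permAverage_transpose, brauerMatrix_transpose, ← hk,
    ← permMatrix_conj_brauerMatrix k g ε hε, permAverage_conj _ _ (Subgroup.mem_top k)]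

/-- The permutations that fix all but the first `n` points. -/
def fixingTail (r n : ℕ) : Subgroup (Equiv.Perm (Fin r)) where
  carrier := {σ | ∀ i : Fin r, n ≤ (i : ℕ) → σ i = i}
  one_mem' _ _ := rfl
  mul_mem' := by
    intro σ τ hσ hτ i hi
    rw [Equiv.Perm.mul_apply, hτ i hi, hσ i hi]
  inv_mem' := by
    intro σ hσ i hi
    rw [Equiv.Perm.inv_eq_iff_eq, hσ i hi]

/-- The colour singles out the point `n`. A reversing `k` therefore fixes `n`, and it fixes every
later point because `g` does, so it lies in the smaller group. -/
theorem permSpan_le_symmAverage (hr : r ≤ 5) (n : ℕ) :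
    permSpan d r (fun σ => σ ∈ fixingTail r (n + 1)) ≤ symmAverage d (fixingTail r n) := by
  refine Submodule.span_le.2 ?_
  rintro _ ⟨g, hg, rfl⟩
  obtain ⟨k, hk, hε, hfix⟩ := exists_reversing hr g fun i => decide ((i : ℕ) = n)
  have hkn : k ∈ fixingTail r n := by
    intro i hi
    rcases Nat.eq_or_lt_of_le hi with h | h
    · have := hε i
      rw [Bool.eq_iff_iff, decide_eq_true_iff, decide_eq_true_iff] at this
      exact Fin.ext ((this.2 h.symm).trans h)
    · exact hfix i (hg i h)
  change (permAverage _ _)ᵀ = permAverage _ _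
  rw [permAverage_transpose, permMatrix_transpose, ← hk, _root_.permMatrix_mul, _root_.permMatrix_mul,
    ← permMatrix_transpose, permAverage_conj _ _ hkn]

end Brauer

/-! ### Orthogonal projections as matrices -/

section Projections

variable {I : Type*} [Fintype I] [DecidableEq I]

/-- The matrix `p` is the Euclidean orthogonal projection onto `W`. -/
structure IsOrthProj (p : Matrix I I ℝ) (W : Submodule ℝ (I → ℝ)) : Prop where
  symm : pᵀ = p
  idem : p * p = p
  mem_iff : ∀ F, F ∈ W ↔ p *ᵥ F = F

theorem ext_mulVec {M N : Matrix I I ℝ} (h : ∀ F, M *ᵥ F = N *ᵥ F) : M = N :=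
  Matrix.toLin'.injective (LinearMap.ext h)

theorem IsOrthProj.mulVec_mem {p : Matrix I I ℝ} {W : Submodule ℝ (I → ℝ)} (h : IsOrthProj p W)
    (F : I → ℝ) : p *ᵥ F ∈ W := by
  rw [h.mem_iff, mulVec_mulVec, h.idem]

theorem exists_isOrthProj (W : Submodule ℝ (I → ℝ)) : ∃ p, IsOrthProj p W := by
  let e := WithLp.linearEquiv 2 ℝ (I → ℝ)
  let W' : Submodule ℝ (EuclideanSpace ℝ I) := W.comap e.toLinearMap
  let P : EuclideanSpace ℝ I →ₗ[ℝ] EuclideanSpace ℝ I := W'.starProjection.toLinearMap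
  let T : (I → ℝ) →ₗ[ℝ] (I → ℝ) := e.toLinearMap ∘ₗ P ∘ₗ e.symm.toLinearMap
  have hTT : ∀ F, T (T F) = T F := by
    intro F
    simp only [T, P, LinearMap.comp_apply, LinearEquiv.coe_coe, LinearEquiv.symm_apply_apply,
      ContinuousLinearMap.coe_coe]
    rw [Submodule.starProjection_eq_self_iff.2 (Submodule.starProjection_apply_mem _ _)]
  have hsymm : ∀ F G, T F ⬝ᵥ G = F ⬝ᵥ T G := by
    intro F G
    have h1 := W'.inner_starProjection_left_eq_right (e.symm F) (e.symm G)
    have h2 : ∀ x y : EuclideanSpace ℝ I, inner ℝ x y = e y ⬝ᵥ e x := by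
      intro x y
      simp [EuclideanSpace.inner_eq_star_dotProduct, e]
    rw [h2, h2] at h1
    rw [dotProduct_comm, dotProduct_comm F]
    simpa [T, P] using h1
  have hpT : ∀ F, LinearMap.toMatrix' T *ᵥ F = T F := fun F => by
    rw [← Matrix.toLin'_apply, Matrix.toLin'_toMatrix']
  refine ⟨LinearMap.toMatrix' T, ?_, ?_, ?_⟩
  · ext i j
    have := hsymm (Pi.single i 1) (Pi.single j 1)
    simp only [dotProduct_single, single_dotProduct, mul_one, one_mul] at this
    simp only [transpose_apply, LinearMap.toMatrix'_apply]
    convert this using 2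
  · refine ext_mulVec fun F => ?_
    rw [← mulVec_mulVec, hpT, hpT, hTT]
  · intro F
    rw [hpT]
    constructor
    · intro h
      have : e.symm F ∈ W' := by simpa [W'] using h
      simp only [T, P, LinearMap.comp_apply, LinearEquiv.coe_coe, ContinuousLinearMap.coe_coe]
      rw [Submodule.starProjection_eq_self_iff.2 this, LinearEquiv.apply_symm_apply]
    · intro h
      rw [← h]
      exact W'.starProjection_apply_mem (e.symm F)

/-- Invariance under `M` gives `pMp = Mp`; invariance under `Mᵀ` gives, after transposing, `pMp =
pM`. -/
theorem IsOrthProj.commute {p : Matrix I I ℝ} {W : Submodule ℝ (I → ℝ)} (h : IsOrthProj p W)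
    {M : Matrix I I ℝ} (h1 : ∀ F ∈ W, M *ᵥ F ∈ W) (h2 : ∀ F ∈ W, Mᵀ *ᵥ F ∈ W) :
    M * p = p * M := by
  have e1 : ∀ N : Matrix I I ℝ, (∀ F ∈ W, N *ᵥ F ∈ W) → p * N * p = N * p := by
    intro N hN
    refine ext_mulVec fun F => ?_
    rw [← mulVec_mulVec, ← mulVec_mulVec, ← mulVec_mulVec,
      (h.mem_iff _).1 (hN _ (h.mulVec_mem F))]
  have e2 := congrArg transpose (e1 _ h2)
  simp only [transpose_mul, transpose_transpose, h.symm] at e2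
  rw [← e1 M h1, Matrix.mul_assoc, e2]

theorem IsOrthProj.mul_eq_of_le {p q : Matrix I I ℝ} {W V : Submodule ℝ (I → ℝ)}
    (hp : IsOrthProj p W) (hq : IsOrthProj q V) (hWV : W ≤ V) : q * p = p ∧ p * q = p := by
  have h1 : q * p = p := ext_mulVec fun F => by
    rw [← mulVec_mulVec]
    exact (hq.mem_iff _).1 (hWV (hp.mulVec_mem F))
  refine ⟨h1, ?_⟩
  have := congrArg transpose h1
  rwa [transpose_mul, hp.symm, hq.symm] at this

theorem exists_eigenvector {y : Matrix I I ℝ} (hy : yᵀ = y) (h0 : y ≠ 0) :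
    ∃ (μ : ℝ) (v : I → ℝ), μ ≠ 0 ∧ v ≠ 0 ∧ y *ᵥ v = μ • v := by
  have hH : y.IsHermitian := by
    rw [IsHermitian, conjTranspose_eq_transpose_of_trivial, hy]
  have h1 : hH.eigenvalues ≠ 0 := fun h => h0 (hH.eigenvalues_eq_zero_iff.1 h)
  obtain ⟨i, hi⟩ := Function.ne_iff.1 h1
  refine ⟨hH.eigenvalues i, hH.eigenvectorBasis i, hi, ?_, hH.mulVec_eigenvectorBasis i⟩
  have := hH.eigenvectorBasis.orthonormal.ne_zero i
  intro h
  apply this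
  ext j
  exact congrFun h j

theorem transpose_mul_self_eq_zero_iff {M : Matrix I I ℝ} : Mᵀ * M = 0 ↔ M = 0 := by
  rw [← conjTranspose_eq_transpose_of_trivial, conjTranspose_mul_self_eq_zero]

theorem finrank_range_lt {f g : Matrix I I ℝ} (hfg : f * g = g) (hgg : g * g = g) {v : I → ℝ}
    (hv : v ≠ 0) (hfv : f *ᵥ v = v) (hgv : g *ᵥ v = 0) :
    Module.finrank ℝ (LinearMap.range g.mulVecLin) <
      Module.finrank ℝ (LinearMap.range f.mulVecLin) := by
  apply Submodule.finrank_lt_finrank_of_lt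
  refine lt_of_le_of_ne ?_ ?_
  · rintro _ ⟨u, rfl⟩
    exact ⟨g *ᵥ u, by rw [mulVecLin_apply, mulVecLin_apply, mulVec_mulVec, hfg]⟩
  · intro h
    have h1 : v ∈ LinearMap.range g.mulVecLin := by
      rw [h]
      exact ⟨v, by rw [mulVecLin_apply, hfv]⟩
    obtain ⟨u, hu⟩ := h1
    apply hv
    rw [← hgv, ← hu, mulVecLin_apply, mulVec_mulVec, hgg]

/-- In an algebra of symmetric matrices there is a minimal idempotent not annihilated by `T`,
provided there is an idempotent not annihilated by `T`. -/
theorem exists_minimal_idempotent (D : Submodule ℝ (Matrix I I ℝ))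
    (hmul : ∀ x ∈ D, ∀ y ∈ D, x * y ∈ D) (hsymm : ∀ x ∈ D, xᵀ = x) (T : Matrix I I ℝ) :
    ∀ f ∈ D, f * f = f → T * f ≠ 0 →
      ∃ e ∈ D, e * e = e ∧ T * e ≠ 0 ∧ ∀ x ∈ D, ∃ c : ℝ, e * x * e = c • e := by
  have hcomm : ∀ x ∈ D, ∀ y ∈ D, x * y = y * x := by
    intro x hx y hy
    rw [← hsymm _ (hmul x hx y hy), transpose_mul, hsymm x hx, hsymm y hy]
  intro f
  induction h : Module.finrank ℝ (LinearMap.range f.mulVecLin) using Nat.strong_induction_on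
    generalizing f with
  | _ n ih =>
  subst h
  intro hf hff hTf
  by_cases hmin : ∀ x ∈ D, ∃ c : ℝ, f * x * f = c • f
  · exact ⟨f, hf, hff, hTf, hmin⟩
  push Not at hmin
  obtain ⟨x, hx, hxc⟩ := hmin
  set y := f * x * f with hy
  have hyD : y ∈ D := hmul _ (hmul f hf x hx) f hf
  have hy0 : y ≠ 0 := fun h => hxc 0 (by rw [h, zero_smul])
  obtain ⟨μ, v, hμ, hv, hyv⟩ := exists_eigenvector (hsymm y hyD) hy0
  have hfy : f * y = y := by rw [hy, ← Matrix.mul_assoc, ← Matrix.mul_assoc, hff]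
  have hfv : f *ᵥ v = v := by
    have : f *ᵥ (μ • v) = μ • v := by rw [← hyv, mulVec_mulVec, hfy]
    rw [mulVec_smul] at this
    exact smul_right_injective _ hμ this
  set z := y - μ • f with hz
  have hzD : z ∈ D := D.sub_mem hyD (D.smul_mem _ hf)
  have hz0 : z ≠ 0 := fun h => hxc μ (sub_eq_zero.1 h)
  have hzv : z *ᵥ v = 0 := by
    rw [hz, sub_mulVec, smul_mulVec, hyv, hfv, sub_self]
  have hfz : f * z = z := by rw [hz, Matrix.mul_sub, hfy, Matrix.mul_smul, hff]
  -- `D` is commutative and consists of symmetric matrices, so it has no nonzero nilpotents. Hence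
  -- multiplication by `z` is injective on `zD`, and so onto it.
  have hinj : ∀ a ∈ D, z * (z * a) = 0 → z * a = 0 := by
    intro a ha h
    rw [← transpose_mul_self_eq_zero_iff, hsymm _ (hmul z hzD a ha)]
    calc z * a * (z * a) = z * (z * a) * a := by
          rw [Matrix.mul_assoc, ← Matrix.mul_assoc a, hcomm a ha z hzD]
          simp only [Matrix.mul_assoc]
      _ = 0 := by rw [h, Matrix.zero_mul]
  let Z : Submodule ℝ (Matrix I I ℝ) := D.map (LinearMap.mulLeft ℝ z)
  have hZD : ∀ a ∈ Z, a ∈ D := by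
    rintro _ ⟨a, ha, rfl⟩
    exact hmul z hzD a ha
  have hstable : ∀ a ∈ Z, LinearMap.mulLeft ℝ z a ∈ Z := fun a ha => ⟨a, hZD a ha, rfl⟩
  have hinj' : Function.Injective ((LinearMap.mulLeft ℝ z).restrict hstable) := by
    rw [← LinearMap.ker_eq_bot, LinearMap.ker_eq_bot']
    rintro ⟨_, ⟨a, ha, rfl⟩⟩ h
    exact Subtype.ext (hinj a ha (congrArg Subtype.val h))
  have hzZ : z ∈ Z := ⟨f, hf, by
    rw [LinearMap.mulLeft_apply, hcomm z hzD f hf, hfz]⟩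
  obtain ⟨⟨w, hw⟩, hzw⟩ := LinearMap.surjective_of_injective hinj' ⟨z, hzZ⟩
  replace hzw : z * w = z := congrArg Subtype.val hzw
  have hwD := hZD w hw
  have hww : w * w = w := by
    obtain ⟨a, ha, haw⟩ := hw
    have haw' : z * a = w := haw
    have h1 : w * w - w = z * (a * w - a) := by
      rw [Matrix.mul_sub, ← Matrix.mul_assoc, haw']
    rw [← sub_eq_zero, h1]
    apply hinj _ (D.sub_mem (hmul a ha w hwD) ha)
    rw [← h1, Matrix.mul_sub, ← Matrix.mul_assoc, hzw, hzw, sub_self]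
  have hwv : w *ᵥ v = 0 := by
    obtain ⟨a, ha, haw⟩ := hw
    have haw' : z * a = w := haw
    rw [← haw', hcomm z hzD a ha, ← mulVec_mulVec, hzv, mulVec_zero]
  have hw0 : w ≠ 0 := fun h => hz0 (by rw [← hzw, h, Matrix.mul_zero])
  have hfw : f * w = w := by
    obtain ⟨a, ha, haw⟩ := hw
    have haw' : z * a = w := haw
    rw [← haw', ← Matrix.mul_assoc, hfz]
  have hwf : w * f = w := by rw [hcomm w hwD f hf, hfw]
  by_cases hTw : T * w = 0
  · have hid : (f - w) * (f - w) = f - w := by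
      rw [Matrix.sub_mul, Matrix.mul_sub, Matrix.mul_sub, hff, hfw, hwf, hww, sub_self, sub_zero]
    obtain ⟨u, hu⟩ : ∃ u, w *ᵥ u ≠ 0 := by
      by_contra! hc
      exact hw0 (ext_mulVec fun F => by rw [hc, zero_mulVec])
    refine ih _ (finrank_range_lt (v := w *ᵥ u) ?_ hid hu ?_ ?_) (f - w) rfl
      (D.sub_mem hf hwD) hid (by rwa [Matrix.mul_sub, hTw, sub_zero])
    · rw [Matrix.mul_sub, hff, hfw]
    · rw [mulVec_mulVec, hfw]
    · rw [mulVec_mulVec, Matrix.sub_mul, hfw, hww, sub_self, zero_mulVec]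
  · exact ih _ (finrank_range_lt hfw hww hv hfv hwv) w rfl hwD hww hTw

end Projections

/-! ### Idempotents of real type -/

section RealType

variable {d r : ℕ}

/-- If compressing the permutations in `H` by the projection `e` only gives multiples of `e`, then
a compressed operator with symmetric average is symmetric. -/
theorem transpose_eq_of_mem_symmAverage {H : Subgroup (Equiv.Perm (Fin r))}
    {e x : Matrix (Fin r → Fin d) (Fin r → Fin d) ℝ} (he : eᵀ = e) (hee : e * e = e)
    (hc : ∀ k ∈ H, ∃ c : ℝ, e * permMatrix d k * e = c • e)
    (hx : e * x * e ∈ symmAverage d H) : (e * x * e)ᵀ = e * x * e := by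
  classical
  by_cases he0 : e = 0
  · simp [he0]
  choose! c hc using hc
  set y := e * x * e with hy
  have hye : e * y * e = y := by
    rw [hy]
    calc e * (e * x * e) * e = (e * e) * x * (e * e) := by simp only [Matrix.mul_assoc]
      _ = _ := by rw [hee]
  have hterm : ∀ k ∈ H, e * (permMatrix d k * y * (permMatrix d k)ᵀ) * e = (c k ^ 2) • y := by
    intro k hk
    have h1 : e * (permMatrix d k)ᵀ * e = c k • e := by
      have := congrArg transpose (hc k hk)
      simpa only [transpose_mul, he, transpose_smul, Matrix.mul_assoc] using this
    calc e * (permMatrix d k * y * (permMatrix d k)ᵀ) * e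
        = (e * permMatrix d k * e) * y * (e * (permMatrix d k)ᵀ * e) := by
          conv_lhs => rw [← hye]
          simp only [Matrix.mul_assoc]
      _ = (c k ^ 2) • (e * y * e) := by
          rw [hc k hk, h1, Matrix.smul_mul, Matrix.smul_mul, Matrix.mul_smul, smul_smul, pow_two]
      _ = _ := by rw [hye]
  -- Compression turns each conjugate of `y` into `(c k)² y`, so `y` is recovered from its symmetric
  -- average up to a positive factor.
  have hsum : e * permAverage H y * e = (∑ k : H, c k ^ 2) • y := by
    rw [permAverage, Matrix.mul_sum, Matrix.sum_mul, Finset.sum_smul]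
    refine Finset.sum_congr (by congr) fun k _ => hterm k k.2
  have hpos : 0 < ∑ k : H, c k ^ 2 := by
    have h1 : c 1 = 1 := by
      have := hc 1 H.one_mem
      rw [_root_.permMatrix_one, Matrix.mul_one, hee] at this
      by_contra h
      have h2 : (1 - c 1) • e = 0 := by rw [sub_smul, one_smul, ← this, sub_self]
      rcases smul_eq_zero.1 h2 with h3 | h3
      · exact h (by linarith)
      · exact he0 h3
    refine Finset.sum_pos' (fun k _ => sq_nonneg _) ⟨1, Finset.mem_univ _, ?_⟩
    simp [h1]
  have hx' : (permAverage H y)ᵀ = permAverage H y := hx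
  have h1 := congrArg transpose hsum
  rw [transpose_mul, transpose_mul, he, hx', ← Matrix.mul_assoc, hsum, transpose_smul] at h1
  exact (smul_right_injective _ hpos.ne' h1).symm

theorem permMatrix_mem_permSpan {p : Equiv.Perm (Fin r) → Prop} {σ : Equiv.Perm (Fin r)}
    (h : p σ) : permMatrix d σ ∈ permSpan d r p :=
  Submodule.subset_span ⟨σ, h, rfl⟩

theorem permSpan_mono {p q : Equiv.Perm (Fin r) → Prop} (h : ∀ σ, p σ → q σ) :
    permSpan d r p ≤ permSpan d r q :=
  Submodule.span_mono fun _ ⟨σ, hσ, hM⟩ => ⟨σ, h σ hσ, hM⟩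

/-- A projection of real type in the span of the permutations of the first `n` positions. -/
structure IsRealType (n : ℕ) (e : Matrix (Fin r → Fin d) (Fin r → Fin d) ℝ) : Prop where
  mem : e ∈ permSpan d r (fun σ => σ ∈ fixingTail r n)
  symm : eᵀ = e
  idem : e * e = e
  compress : ∀ x ∈ permSpan d r (fun σ => σ ∈ fixingTail r n), ∃ c : ℝ, e * x * e = c • e

/-- Climb from `n` to `n + 1`. With `e` of real type for the smaller group, reversal inside that
group makes every compression `exe` symmetric for `x` in the larger group algebra. These
compressions form a commutative algebra, and a minimal idempotent in it is of real type one level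
up. Tracking `T` keeps it from being annihilated. -/
theorem exists_isRealType (hr : r ≤ 5) (n : ℕ)
    (T : Matrix (Fin r → Fin d) (Fin r → Fin d) ℝ) (hT : T ≠ 0) :
    ∃ e : Matrix (Fin r → Fin d) (Fin r → Fin d) ℝ, IsRealType n e ∧ T * e ≠ 0 := by
  induction n with
  | zero =>
    refine ⟨1, ⟨?_, transpose_one, Matrix.mul_one 1, fun x hx => ?_⟩, by rwa [Matrix.mul_one]⟩
    · rw [← _root_.permMatrix_one]
      exact permMatrix_mem_permSpan (Subgroup.one_mem _)
    · simp only [Matrix.one_mul, Matrix.mul_one]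
      induction hx using Submodule.span_induction with
      | mem x h =>
        obtain ⟨σ, hσ, rfl⟩ := h
        have : σ = 1 := Equiv.ext fun i => hσ i (Nat.zero_le _)
        exact ⟨1, by rw [this, _root_.permMatrix_one, one_smul]⟩
      | zero => exact ⟨0, by rw [zero_smul]⟩
      | add x y _ _ h1 h2 =>
        obtain ⟨a, rfl⟩ := h1
        obtain ⟨b, rfl⟩ := h2
        exact ⟨a + b, (add_smul _ _ _).symm⟩
      | smul c x _ h =>
        obtain ⟨a, rfl⟩ := h
        exact ⟨c * a, (mul_smul _ _ _).symm⟩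
  | succ n ih =>
    obtain ⟨e, he, hTe⟩ := ih
    have hmul : ∀ x ∈ permSpan d r (fun σ => σ ∈ fixingTail r (n + 1)),
        ∀ y ∈ permSpan d r (fun σ => σ ∈ fixingTail r (n + 1)),
        x * y ∈ permSpan d r (fun σ => σ ∈ fixingTail r (n + 1)) :=
      fun x hx y hy => mul_mem_permSpan (fun σ τ => (fixingTail r (n + 1)).mul_mem) hx hy
    have heA : e ∈ permSpan d r (fun σ => σ ∈ fixingTail r (n + 1)) :=
      permSpan_mono (fun σ hσ i hi => hσ i (by omega)) he.mem
    let D : Submodule ℝ (Matrix (Fin r → Fin d) (Fin r → Fin d) ℝ) :=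
      (permSpan d r (fun σ => σ ∈ fixingTail r (n + 1))).map
        (LinearMap.mulRight ℝ e ∘ₗ LinearMap.mulLeft ℝ e)
    have hD : ∀ x ∈ D, x ∈ permSpan d r (fun σ => σ ∈ fixingTail r (n + 1)) ∧
        e * x = x ∧ x * e = x := by
      rintro _ ⟨x, hx, rfl⟩
      refine ⟨hmul _ (hmul _ heA _ hx) _ heA, ?_, ?_⟩
      · simp only [LinearMap.comp_apply, LinearMap.mulLeft_apply, LinearMap.mulRight_apply]
        rw [← Matrix.mul_assoc, ← Matrix.mul_assoc, he.idem]
      · simp only [LinearMap.comp_apply, LinearMap.mulLeft_apply, LinearMap.mulRight_apply]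
        rw [Matrix.mul_assoc, he.idem]
    have hD' : ∀ x ∈ permSpan d r (fun σ => σ ∈ fixingTail r (n + 1)), e * x * e ∈ D :=
      fun x hx => ⟨x, hx, rfl⟩
    have hDmul : ∀ x ∈ D, ∀ y ∈ D, x * y ∈ D := by
      intro x hx y hy
      obtain ⟨hx1, hx2, hx3⟩ := hD x hx
      obtain ⟨hy1, hy2, hy3⟩ := hD y hy
      have := hD' _ (hmul x hx1 y hy1)
      rwa [← Matrix.mul_assoc, hx2, Matrix.mul_assoc, hy3] at this
    have hDsymm : ∀ x ∈ D, xᵀ = x := by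
      intro x hx
      have h1 := (hD _ hx).1
      obtain ⟨x, hx, rfl⟩ := hx
      exact transpose_eq_of_mem_symmAverage he.symm he.idem
        (fun k hk => he.compress _ (permMatrix_mem_permSpan hk))
        (permSpan_le_symmAverage hr n h1)
    have heD : e ∈ D := by
      have := hD' e heA
      rwa [he.idem, he.idem] at this
    obtain ⟨f, hfD, hff, hTf, hmin⟩ := exists_minimal_idempotent D hDmul hDsymm T e heD he.idem hTe
    obtain ⟨hfA, hef, hfe⟩ := hD f hfD
    refine ⟨f, ⟨hfA, ?_, hff, fun x hx => ?_⟩, hTf⟩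
    · obtain ⟨x, hx, rfl⟩ := hfD
      exact transpose_eq_of_mem_symmAverage he.symm he.idem
        (fun k hk => he.compress _ (permMatrix_mem_permSpan hk))
        (permSpan_le_symmAverage hr n hfA)
    · obtain ⟨c, hc⟩ := hmin _ (hD' x hx)
      refine ⟨c, ?_⟩
      rw [← hc]
      calc f * x * f = (f * e) * x * (e * f) := by rw [hef, hfe]
        _ = _ := by simp only [Matrix.mul_assoc]

/-- A projection whose symmetric compressed operators are scalar is of real type. -/
theorem exists_compress_eq_smul (hr : r ≤ 5) {Y : Matrix (Fin r → Fin d) (Fin r → Fin d) ℝ}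
    (hY0 : Y ≠ 0) (hYt : Yᵀ = Y) (hYA : Y ∈ permSpan d r fun _ => True)
    (hY : ∀ x ∈ permSpan d r (fun _ => True), (Y * x * Y)ᵀ = Y * x * Y →
      ∃ c : ℝ, Y * x * Y = c • Y)
    {x : Matrix (Fin r → Fin d) (Fin r → Fin d) ℝ} (hx : x ∈ permSpan d r fun _ => True) :
    ∃ c : ℝ, Y * x * Y = c • Y := by
  have htop : ∀ y ∈ permSpan d r (fun _ => True),
      y ∈ permSpan d r (fun σ => σ ∈ fixingTail r r) := fun y hy =>
    permSpan_mono (fun σ _ i hi => absurd i.2 (by omega)) hy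
  have hmul : ∀ x ∈ permSpan d r (fun _ => True), ∀ y ∈ permSpan d r (fun _ => True),
      x * y ∈ permSpan d r (fun _ => True) :=
    fun x hx y hy => mul_mem_permSpan (fun _ _ _ _ => trivial) hx hy
  obtain ⟨f, hf, hYf⟩ := exists_isRealType hr r Y hY0
  have hfA : f ∈ permSpan d r (fun _ => True) := permSpan_mono (fun _ _ => trivial) hf.mem
  have hsq : (f * Y)ᵀ * (f * Y) = Y * f * Y := by
    rw [transpose_mul, hf.symm, hYt]
    calc Y * f * (f * Y) = Y * (f * f) * Y := by simp only [Matrix.mul_assoc]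
      _ = _ := by rw [hf.idem]
  -- `YfY = (fY)ᵀ(fY)` is symmetric and nonzero, so it is a nonzero multiple of `Y`. This transfers
  -- real type from `f` to `Y`.
  obtain ⟨c, hc⟩ := hY f hfA (by rw [← hsq, transpose_mul, transpose_transpose])
  have hc0 : c ≠ 0 := by
    rintro rfl
    rw [zero_smul, ← hsq, transpose_mul_self_eq_zero_iff] at hc
    apply hYf
    have := congrArg transpose hc
    rwa [transpose_mul, hf.symm, hYt, transpose_zero] at this
  obtain ⟨a, ha⟩ := hf.compress (Y * x * Y) (htop _ (hmul _ (hmul _ hYA _ hx) _ hYA))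
  refine ⟨a / c, ?_⟩
  have h1 : (c * c) • (Y * x * Y) = (a * c) • Y := by
    calc (c * c) • (Y * x * Y) = (c • Y) * x * (c • Y) := by
          rw [Matrix.smul_mul, Matrix.smul_mul, Matrix.mul_smul, smul_smul]
      _ = Y * (f * (Y * x * Y) * f) * Y := by
          rw [← hc]
          simp only [Matrix.mul_assoc]
      _ = (a * c) • Y := by
          rw [ha, Matrix.mul_smul, Matrix.smul_mul, hc, smul_smul]
  have h2 : (c * c) • (Y * x * Y) = (c * c) • ((a / c) • Y) := by
    rw [h1, smul_smul]
    congr 1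
    field_simp
  exact smul_right_injective _ (mul_ne_zero hc0 hc0) h2

end RealType

/-! ### Products of metrics and trace-free tensors -/

section TraceFree

variable {d r s t : ℕ}

theorem metricMul_add (σ : (Fin t × Fin 2) ⊕ Fin s ≃ Fin r) (f g : Tensor d s) :
    metricMul σ (f + g) = metricMul σ f + metricMul σ g := by
  ext a
  simp [metricMul, mul_add]

theorem metricMul_smul (σ : (Fin t × Fin 2) ⊕ Fin s ≃ Fin r) (c : ℝ) (f : Tensor d s) :
    metricMul σ (c • f) = c • metricMul σ f := by
  ext a
  simp [metricMul, mul_left_comm]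

/-- `metricMul` as a linear map. -/
def metricMulLin (d : ℕ) (σ : (Fin t × Fin 2) ⊕ Fin s ≃ Fin r) : Tensor d s →ₗ[ℝ] Tensor d r where
  toFun := metricMul σ
  map_add' := metricMul_add σ
  map_smul' := metricMul_smul σ

theorem permMatrix_mulVec_metricMul (τ : Equiv.Perm (Fin r))
    (σ : (Fin t × Fin 2) ⊕ Fin s ≃ Fin r) (f : Tensor d s) :
    permMatrix d τ *ᵥ metricMul σ f = metricMul (σ.trans τ) f := by
  rw [permMatrix_mulVec]
  rfl

theorem sum_prod_pairs (F : Fin t → Fin d → Fin d → ℝ) :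
    ∑ x : Fin t × Fin 2 → Fin d, ∏ k, F k (x (k, 0)) (x (k, 1)) = ∏ k, ∑ p, ∑ q, F k p q := by
  have h1 : ∀ k, ∑ p, ∑ q, F k p q = ∑ z : Fin d × Fin d, F k z.1 z.2 := fun k => by
    rw [Fintype.sum_prod_type]
  simp only [h1]
  rw [Finset.prod_univ_sum, Fintype.piFinset_univ]
  exact Fintype.sum_equiv ((Equiv.curry _ _ _).trans
    (Equiv.piCongrRight fun _ => finTwoArrowEquiv (Fin d))) _ _ fun x => rfl

theorem IsLorentz.sum_sum_mul {g : Matrix (Fin d) (Fin d) ℝ} (hg : IsLorentz g) (x y : Fin d) :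
    ∑ p, ∑ q, g x p * g y q * minkowski d p q = minkowski d x y := by
  conv_rhs => rw [← hg.mul_minkowski_mul]
  simp only [mul_apply, transpose_apply, Finset.sum_mul]
  rw [Finset.sum_comm]
  exact Finset.sum_congr rfl fun q _ => Finset.sum_congr rfl fun p _ => by ring

/-- Each metric factor absorbs its two copies of `g` through `g η gᵀ = η`. -/
theorem IsLorentz.tensorPower_mulVec_metricMul {g : Matrix (Fin d) (Fin d) ℝ} (hg : IsLorentz g)
    (σ : (Fin t × Fin 2) ⊕ Fin s ≃ Fin r) (f : Tensor d s) :
    tensorPower r g *ᵥ metricMul σ f = metricMul σ (tensorPower s g *ᵥ f) := by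
  ext a
  simp only [mulVec, dotProduct, metricMul]
  rw [← (((Equiv.sumArrowEquivProdArrow _ _ (Fin d)).symm.trans
    (Equiv.arrowCongr σ (Equiv.refl (Fin d))))).sum_comp, Fintype.sum_prod_type]
  have h1 : ∀ (x : Fin t × Fin 2 → Fin d) (y : Fin s → Fin d) (w : Fin r → Fin d),
      (∀ z, w (σ z) = Sum.elim x y z) → tensorPower r g a w =
        (∏ k, g (a (σ (Sum.inl (k, 0)))) (x (k, 0)) * g (a (σ (Sum.inl (k, 1)))) (x (k, 1))) *
          tensorPower s g (fun j => a (σ (Sum.inr j))) y := by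
    intro x y w hw
    rw [tensorPower, of_apply, ← σ.prod_comp, Fintype.prod_sum_type, Fintype.prod_prod_type]
    simp only [hw, Sum.elim_inl, Sum.elim_inr, Fin.prod_univ_two]
    rfl
  have h2 : ∀ (x : Fin t × Fin 2 → Fin d) (y : Fin s → Fin d) z,
      ((Equiv.sumArrowEquivProdArrow _ _ (Fin d)).symm.trans
        (Equiv.arrowCongr σ (Equiv.refl (Fin d)))) (x, y) (σ z) = Sum.elim x y z := by
    intro x y z
    simp [Equiv.sumArrowEquivProdArrow, Equiv.arrowCongr]
  simp only [h1 _ _ _ (h2 _ _), h2, Sum.elim_inl, Sum.elim_inr]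
  have h3 : ∀ k, minkowski d (a (σ (Sum.inl (k, 0)))) (a (σ (Sum.inl (k, 1)))) =
      ∑ p, ∑ q, g (a (σ (Sum.inl (k, 0)))) p * g (a (σ (Sum.inl (k, 1)))) q * minkowski d p q :=
    fun k => (hg.sum_sum_mul _ _).symm
  simp only [h3]
  rw [← sum_prod_pairs, Finset.sum_mul]
  refine Finset.sum_congr rfl fun x _ => ?_
  rw [Finset.mul_sum]
  refine Finset.sum_congr rfl fun y _ => ?_
  simp only [Finset.prod_mul_distrib]
  ring

theorem exists_metricMul_metricMul {t' s' : ℕ} (σ : (Fin t × Fin 2) ⊕ Fin s ≃ Fin r)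
    (σ' : (Fin t' × Fin 2) ⊕ Fin s' ≃ Fin s) :
    ∃ ρ : (Fin (t + t') × Fin 2) ⊕ Fin s' ≃ Fin r, ∀ u : Tensor d s',
      metricMul σ (metricMul σ' u) = metricMul ρ u := by
  refine ⟨(((((finSumFinEquiv.symm.prodCongr (Equiv.refl (Fin 2))).trans
    (Equiv.sumProdDistrib _ _ _)).sumCongr (Equiv.refl (Fin s'))).trans
    (Equiv.sumAssoc _ _ _)).trans ((Equiv.refl _).sumCongr σ')).trans σ, fun u => ?_⟩
  ext a
  simp only [metricMul, Fin.prod_univ_add, mul_assoc]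
  congr 1
  · refine Finset.prod_congr rfl fun k _ => ?_
    simp
  · congr 1
    · refine Finset.prod_congr rfl fun k _ => ?_
      simp

theorem exists_pair_equiv (i j : Fin (s + 2)) (h : i ≠ j) :
    ∃ σ : (Fin 1 × Fin 2) ⊕ Fin s ≃ Fin (s + 2),
      σ (Sum.inl (0, 0)) = i ∧ σ (Sum.inl (0, 1)) = j := by
  obtain ⟨π, h0, h1⟩ := exists_perm_zero_one i j h
  refine ⟨(((Equiv.uniqueProd (Fin 2) (Fin 1)).sumCongr (Equiv.refl (Fin s))).trans
    (finSumFinEquiv.trans (finCongr (Nat.add_comm 2 s)))).trans π, ?_, ?_⟩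
  · rw [← h0, Equiv.trans_apply]
    congr 1
  · rw [← h1, Equiv.trans_apply]
    congr 1

theorem sum_sum_update (i : Fin s) (G : (Fin s → Fin d) → ℝ) :
    ∑ b, ∑ x, G (Function.update b i x) = d * ∑ b, G b := by
  have h1 : ∑ b, ∑ x, G (Function.update b i x) = ∑ b : Fin s → Fin d, ∑ _x : Fin d, G b := by
    rw [← Fintype.sum_prod_type', ← Fintype.sum_prod_type']
    have hinv : Function.Involutive fun z : (Fin s → Fin d) × Fin d =>
        (Function.update z.1 i z.2, z.1 i) := by
      rintro ⟨b, x⟩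
      simp
    exact Fintype.sum_equiv hinv.toPerm _ _ fun z => rfl
  rw [h1, Finset.mul_sum]
  simp

/-- Summing the trace condition over all `b` counts every term `d²` times, since the entries of `b`
at `i` and `j` are overwritten; `v` does not depend on them. -/
theorem IsTraceFree.sum_eq_zero {F : Tensor d s} (hF : IsTraceFree F) {i j : Fin s} (hij : i ≠ j)
    (v : (Fin s → Fin d) → ℝ)
    (hv : ∀ b x y, v (Function.update (Function.update b i x) j y) = v b) :
    ∑ b, minkowski d (b i) (b j) * v b * F b = 0 := by
  rcases Nat.eq_zero_or_pos d with rfl | hd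
  · exact Finset.sum_eq_zero fun b _ => (b i).elim0
  have h1 := sum_sum_update i fun b => ∑ y, minkowski d (Function.update b j y i)
    (Function.update b j y j) * v (Function.update b j y) * F (Function.update b j y)
  rw [sum_sum_update j (fun b => minkowski d (b i) (b j) * v b * F b)] at h1
  have h2 : ∀ b : Fin s → Fin d, ∑ x, ∑ y, minkowski d
      (Function.update (Function.update b i x) j y i)
      (Function.update (Function.update b i x) j y j) *
      v (Function.update (Function.update b i x) j y) *
      F (Function.update (Function.update b i x) j y) = 0 := by
    intro b
    have := congrArg (fun z => v b * z) (hF i j hij b)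
    simp only [mul_zero, Finset.mul_sum] at this
    rw [← this]
    refine Finset.sum_congr rfl fun x _ => Finset.sum_congr rfl fun y _ => ?_
    rw [hv, Function.update_of_ne hij, Function.update_self, Function.update_self]
    ring
  simp only [h2, Finset.sum_const_zero] at h1
  have hd' : (d : ℝ) ≠ 0 := by positivity
  simpa [hd'] using h1.symm

/-- Trace-free tensors are those that are orthogonal to all multiples of metrics. -/
theorem isTraceFree_iff (f : Tensor d s) : IsTraceFree f ↔
    ∀ (s' : ℕ) (σ : (Fin 1 × Fin 2) ⊕ Fin s' ≃ Fin s) (u : Tensor d s'),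
      metricMul σ u ⬝ᵥ f = 0 := by
  constructor
  · intro hf s' σ u
    have hij : σ (Sum.inl (0, 0)) ≠ σ (Sum.inl (0, 1)) := by simp
    have := hf.sum_eq_zero hij (fun b => u fun j => b (σ (Sum.inr j))) (by
      intro b x y
      congr 1
      ext l
      rw [Function.update_of_ne (by simp), Function.update_of_ne (by simp)])
    simpa [dotProduct, metricMul] using this
  · intro hf i j hij c
    obtain ⟨m, rfl⟩ : ∃ m, s = m + 2 := by
      refine ⟨s - 2, ?_⟩
      have := i.2
      have := j.2
      have : (i : ℕ) ≠ j := fun h => hij (Fin.ext h)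
      omega
    obtain ⟨σ, h0, h1⟩ := exists_pair_equiv i j hij
    have h2 := hf m σ (Pi.single (fun l => c (σ (Sum.inr l))) 1)
    rw [← h2, dotProduct, ← Fintype.sum_prod_type']
    have hi : ∀ l, σ (Sum.inr l) ≠ i := fun l => by rw [← h0]; simp
    have hj : ∀ l, σ (Sum.inr l) ≠ j := fun l => by rw [← h1]; simp
    refine Finset.sum_of_injOn
      (fun z : Fin d × Fin d => Function.update (Function.update c i z.1) j z.2) ?_ ?_ ?_ ?_
    · rintro ⟨x, y⟩ _ ⟨x', y'⟩ _ h
      have e1 := congrFun h i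
      have e2 := congrFun h j
      simp only [Function.update_self, Function.update_of_ne hij] at e1 e2
      rw [e1, e2]
    · simp
    · intro a _ ha
      have hne : (fun l => a (σ (Sum.inr l))) ≠ fun l => c (σ (Sum.inr l)) := by
        intro h
        apply ha
        refine ⟨(a i, a j), by simp, ?_⟩
        ext l
        obtain ⟨z, rfl⟩ := σ.surjective l
        rcases z with ⟨k, b⟩ | l
        · rw [Subsingleton.elim k 0]
          fin_cases b
          · simp [h0, Function.update_of_ne hij]
          · simp [h1]
        · simp only [Function.update_of_ne (hi l), Function.update_of_ne (hj l)]
          rw [← congrFun h l]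
      simp [metricMul, Pi.single_eq_of_ne hne]
    · rintro ⟨x, y⟩ _
      simp [metricMul, h0, h1, Function.update_of_ne hij, Function.update_of_ne (hi _),
        Function.update_of_ne (hj _)]

/-- The space of trace-free tensors. -/
def traceFree (d s : ℕ) : Submodule ℝ (Tensor d s) where
  carrier := {f | IsTraceFree f}
  zero_mem' := by
    intro i j _ c
    simp
  add_mem' := by
    intro f g hf hg
    simp only [Set.mem_ofPred_eq, isTraceFree_iff] at *
    intro s' σ u
    rw [dotProduct_add, hf, hg, add_zero]
  smul_mem' := by
    intro c f hf
    simp only [Set.mem_ofPred_eq, isTraceFree_iff] at *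
    intro s' σ u
    rw [dotProduct_smul, hf, smul_zero]

theorem mem_traceFree {f : Tensor d s} : f ∈ traceFree d s ↔ IsTraceFree f := Iff.rfl

theorem permMatrix_mulVec_mem_traceFree (τ : Equiv.Perm (Fin s)) {f : Tensor d s}
    (hf : f ∈ traceFree d s) : permMatrix d τ *ᵥ f ∈ traceFree d s := by
  rw [mem_traceFree, isTraceFree_iff] at *
  intro s' σ u
  rw [dotProduct_mulVec, ← mulVec_transpose, permMatrix_transpose, permMatrix_mulVec_metricMul, hf]

theorem IsLorentz.mulVec_mem_traceFree {g : Matrix (Fin d) (Fin d) ℝ} (hg : IsLorentz g)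
    {f : Tensor d s} (hf : f ∈ traceFree d s) : tensorPower s g *ᵥ f ∈ traceFree d s := by
  rw [mem_traceFree, isTraceFree_iff] at *
  intro s' σ u
  rw [dotProduct_mulVec, ← mulVec_transpose, ← tensorPower_transpose,
    hg.transpose.tensorPower_mulVec_metricMul, hf]

/-- Every tensor is a combination of products of metrics and trace-free tensors. -/
theorem eq_zero_of_orthogonal_metricMul (F : Tensor d r)
    (hF : ∀ (t s : ℕ) (σ : (Fin t × Fin 2) ⊕ Fin s ≃ Fin r), ∀ f ∈ traceFree d s,
      metricMul σ f ⬝ᵥ F = 0) : F = 0 := by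
  have key : ∀ (s t : ℕ) (σ : (Fin t × Fin 2) ⊕ Fin s ≃ Fin r) (u : Tensor d s),
      metricMul σ u ⬝ᵥ F = 0 := by
    intro s
    induction s using Nat.strong_induction_on with
    | _ s ih =>
    intro t σ
    let M := LinearMap.toMatrix' (metricMulLin d σ)
    have hM : ∀ u, metricMul σ u ⬝ᵥ F = u ⬝ᵥ (Mᵀ *ᵥ F) := by
      intro u
      have : M *ᵥ u = metricMul σ u := by
        rw [← Matrix.toLin'_apply, Matrix.toLin'_toMatrix']
        rfl
      rw [dotProduct_mulVec, vecMul_transpose, this]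
    -- Pairing the adjoint image of `F` with a further metric gives a product with fewer free
    -- indices, zero by induction. So it is trace-free, and then `hF` makes it orthogonal to itself.
    have h1 : Mᵀ *ᵥ F ∈ traceFree d s := by
      rw [mem_traceFree, isTraceFree_iff]
      intro s' σ' u
      obtain ⟨ρ, hρ⟩ := exists_metricMul_metricMul (d := d) σ σ'
      have hs : s' < s := by
        have := Fintype.card_congr σ'
        simp at this
        omega
      rw [← hM, hρ, ih s' hs]
    have h2 : Mᵀ *ᵥ F = 0 := by
      rw [← dotProduct_self_eq_zero, ← hM]
      exact hF t s σ _ h1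
    intro u
    rw [hM, h2, dotProduct_zero]
  rw [← dotProduct_self_eq_zero]
  have h := key r 0 (Equiv.emptySum _ _) F
  rwa [show metricMul (Equiv.emptySum (Fin 0 × Fin 2) (Fin r)) F = F by ext a; simp [metricMul]] at h

/-- A Brauer diagram either annihilates trace-free tensors or is a permutation followed by lowering
the indices. -/
theorem brauerMatrix_traceFree (g : Equiv.Perm (Fin r)) (ε : Fin r → Bool) :
    (∀ F ∈ traceFree d r, brauerMatrix d g ε *ᵥ F = 0) ∨
      ∃ σ, brauerMatrix d g ε = permMatrix d σ * tensorPower r (minkowski d) := by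
  -- Such an `i` contributes the factor `η(b i, b (g i))`, a contraction of two input indices.
  by_cases h : ∃ i, ε i = false ∧ ε (g i) = true
  · left
    obtain ⟨i, hi, hgi⟩ := h
    intro F hF
    have hne : i ≠ g i := by
      intro h
      rw [← h, hi] at hgi
      simp at hgi
    ext a
    refine Eq.trans ?_ (IsTraceFree.sum_eq_zero hF hne (fun b => ∏ l ∈ Finset.univ.erase i,
      minkowski d (cond (ε l) (a l) (b l)) (cond (ε (g l)) (b (g l)) (a (g l)))) ?_)
    · simp only [mulVec, dotProduct, brauerMatrix, of_apply]
      refine Finset.sum_congr rfl fun b _ => ?_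
      rw [← Finset.mul_prod_erase _ _ (Finset.mem_univ i), hi, hgi]
      rfl
    · intro b x y
      refine Finset.prod_congr rfl fun l hl => ?_
      have hl : l ≠ i := Finset.ne_of_mem_erase hl
      congr 1
      · cases hl2 : ε l
        · have : l ≠ g i := by
            rintro rfl
            rw [hgi] at hl2
            simp at hl2
          simp [Function.update_of_ne this, Function.update_of_ne hl]
        · rfl
      · cases hl2 : ε (g l)
        · rfl
        · have h1 : g l ≠ g i := fun h => hl (g.injective h)
          have h2 : g l ≠ i := by
            rintro h
            rw [h, hi] at hl2
            simp at hl2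
          simp [Function.update_of_ne h1, Function.update_of_ne h2]
  · right
    push Not at h
    -- Otherwise `g` preserves both colour classes. Undoing the partial transposition leaves a
    -- permutation: `g⁻¹` on the true class, `g` on the false one.
    have h1 : ∀ i, ε i = false → ε (g i) = false := fun i hi => by simpa using h i hi
    have h2 : ∀ i, ε (g⁻¹ i) = ε i := by
      intro i
      cases hi : ε i
      · exact Equiv.Perm.perm_symm_on_of_perm_on_finite h1 hi
      · by_contra hc
        have := h1 (g⁻¹ i) (by simpa using hc)
        rw [← Equiv.Perm.mul_apply, mul_inv_cancel, Equiv.Perm.one_apply, hi] at this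
        simp at this
    have h3 : ∀ i, ε (g i) = ε i := fun i => by
      have := h2 (g i)
      rw [← Equiv.Perm.mul_apply, inv_mul_cancel, Equiv.Perm.one_apply] at this
      exact this.symm
    let σ : Equiv.Perm (Fin r) :=
      { toFun := fun i => if ε i then g⁻¹ i else g i
        invFun := fun i => if ε i then g i else g⁻¹ i
        left_inv := by
          intro i
          by_cases hi : ε i <;> simp only [hi, if_true, h2, h3, Bool.false_eq_true, if_false]
          · exact g.apply_symm_apply i
          · exact g.symm_apply_apply i
        right_inv := by
          intro i
          by_cases hi : ε i <;> simp only [hi, if_true, h2, h3, Bool.false_eq_true, if_false]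
          · exact g.symm_apply_apply i
          · exact g.apply_symm_apply i }
    refine ⟨σ, ?_⟩
    ext a b
    rw [permMatrix_mul_apply]
    simp only [brauerMatrix, tensorPower, of_apply, h3]
    have e1 : ∀ i, minkowski d (cond (ε i) (a i) (b i)) (cond (ε i) (b (g i)) (a (g i))) =
        (if ε i then minkowski d (a i) (b (g i)) else 1) *
          (if ε i then 1 else minkowski d (a (g i)) (b i)) := by
      intro i
      cases ε i
      · simp [minkowski_symm]
      · simp
    have e2 : ∀ i, minkowski d ((a ∘ σ) i) (b i) =
        (if ε i then minkowski d (a (g⁻¹ i)) (b i) else 1) *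
          (if ε i then 1 else minkowski d (a (g i)) (b i)) := by
      intro i
      simp only [σ, Function.comp, Equiv.coe_fn_mk]
      cases ε i <;> simp
    simp only [e1, e2, Finset.prod_mul_distrib]
    congr 1
    refine Fintype.prod_equiv g _ _ fun i => ?_
    have hi : g⁻¹ (g i) = i := g.symm_apply_apply i
    rw [h3, hi]

/-- On trace-free tensors, an operator commuting with the Lorentz group acts as a linear
combination of permutations. -/
theorem IsLorentzEquivariant.exists_permSpan {T : Matrix (Fin r → Fin d) (Fin r → Fin d) ℝ}
    (hT : IsLorentzEquivariant T) : ∃ S ∈ permSpan d r fun _ => True,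
      ∀ F ∈ traceFree d r, T *ᵥ F = S *ᵥ F := by
  have hΘ : IsLorentz (minkowski d) := by
    rw [IsLorentz, minkowski_transpose, minkowski_mul_self, Matrix.one_mul]
  have hΘΘ : tensorPower r (minkowski d) * tensorPower r (minkowski d) = 1 :=
    tensorPower_mul_eq_one (minkowski_mul_self d)
  have hB := hT.mem_brauerSpan
  suffices h : ∀ M ∈ brauerSpan d r, ∃ S ∈ permSpan d r fun _ => True,
      ∀ F ∈ traceFree d r, M *ᵥ F = (S * tensorPower r (minkowski d)) *ᵥ F by
    obtain ⟨S, hS, h⟩ := h _ hB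
    refine ⟨S, hS, fun F hF => ?_⟩
    have := h _ (hΘ.mulVec_mem_traceFree hF)
    simpa only [mulVec_mulVec, Matrix.mul_assoc, hΘΘ, Matrix.mul_one] using this
  intro M hM
  induction hM using Submodule.span_induction with
  | mem M h =>
    obtain ⟨g, ε, rfl⟩ := h
    rcases brauerMatrix_traceFree (d := d) g ε with h | ⟨σ, h⟩
    · exact ⟨0, Submodule.zero_mem _, fun F hF => by rw [h F hF, Matrix.zero_mul, zero_mulVec]⟩
    · exact ⟨_, permMatrix_mem σ, fun F _ => by rw [h]⟩
  | zero => exact ⟨0, Submodule.zero_mem _, fun F _ => by rw [Matrix.zero_mul]⟩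
  | add M N _ _ h1 h2 =>
    obtain ⟨S, hS, h1⟩ := h1
    obtain ⟨S', hS', h2⟩ := h2
    exact ⟨S + S', Submodule.add_mem _ hS hS', fun F hF => by
      rw [Matrix.add_mul, add_mulVec, add_mulVec, h1 F hF, h2 F hF]⟩
  | smul c M _ h =>
    obtain ⟨S, hS, h⟩ := h
    exact ⟨c • S, Submodule.smul_mem _ _ hS, fun F hF => by
      rw [Matrix.smul_mul, smul_mulVec, smul_mulVec, h F hF]⟩

end TraceFree

/-! ### Invariant subspaces -/

section Invariant

variable {d r s : ℕ}

theorem glAct_apply (g : GL (Fin d) ℝ) (F : Tensor d r) :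
    glAct r g F = tensorPower r (g : Matrix (Fin d) (Fin d) ℝ) *ᵥ F := by
  rw [glAct, Matrix.toLin'_apply]

theorem mem_lorentzGroup {g : GL (Fin d) ℝ} :
    g ∈ lorentzGroup d ↔ IsLorentz (g : Matrix (Fin d) (Fin d) ℝ) := Iff.rfl

theorem IsLorentz.exists_unit {g : Matrix (Fin d) (Fin d) ℝ} (hg : IsLorentz g) :
    ∃ u ∈ lorentzGroup d, (u : Matrix (Fin d) (Fin d) ℝ) = g := by
  have h1 : (minkowski d * gᵀ * minkowski d) * g = 1 := by
    rw [Matrix.mul_assoc, Matrix.mul_assoc, ← Matrix.mul_assoc gᵀ, hg, minkowski_mul_self]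
  exact ⟨⟨g, _, mul_eq_one_comm.1 h1, h1⟩, hg, rfl⟩

/-- The subgroup `G` of the general linear group is closed under transposition. -/
def TransposeClosed (G : Subgroup (GL (Fin d) ℝ)) : Prop :=
  ∀ g ∈ G, ∃ h ∈ G, (h : Matrix (Fin d) (Fin d) ℝ) = (g : Matrix (Fin d) (Fin d) ℝ)ᵀ

theorem transposeClosed_top : TransposeClosed (⊤ : Subgroup (GL (Fin d) ℝ)) := by
  intro g _
  refine ⟨⟨(g : Matrix (Fin d) (Fin d) ℝ)ᵀ, ((g⁻¹ : GL (Fin d) ℝ) : Matrix (Fin d) (Fin d) ℝ)ᵀ,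
    ?_, ?_⟩, Subgroup.mem_top _, rfl⟩
  · rw [← transpose_mul, ← Units.val_mul, inv_mul_cancel, Units.val_one, transpose_one]
  · rw [← transpose_mul, ← Units.val_mul, mul_inv_cancel, Units.val_one, transpose_one]

theorem transposeClosed_lorentzGroup : TransposeClosed (lorentzGroup d) := fun _ hg =>
  (mem_lorentzGroup.1 hg).transpose.exists_unit

variable {G : Subgroup (GL (Fin d) ℝ)} {V W : Submodule ℝ (Tensor d r)}
  {p : Matrix (Fin r → Fin d) (Fin r → Fin d) ℝ}

/-- Since `tensorPower` respects transposes, `hG` supplies the invariance under `Mᵀ` that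
`IsOrthProj.commute` needs. -/
theorem IsInvariantUnder.commute (hG : TransposeClosed G) (hW : IsInvariantUnder G W)
    (hp : IsOrthProj p W) {g : GL (Fin d) ℝ} (hg : g ∈ G) :
    tensorPower r (g : Matrix (Fin d) (Fin d) ℝ) * p =
      p * tensorPower r (g : Matrix (Fin d) (Fin d) ℝ) := by
  obtain ⟨h, hh, hhg⟩ := hG g hg
  refine hp.commute (fun F hF => ?_) fun F hF => ?_
  · rw [← glAct_apply]
    exact hW g hg F hF
  · rw [← tensorPower_transpose, ← hhg, ← glAct_apply]
    exact hW h hh F hF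

theorem IsInvariantUnder.inf (hV : IsInvariantUnder G V) (hW : IsInvariantUnder G W) :
    IsInvariantUnder G (V ⊓ W) :=
  fun g hg F hF => ⟨hV g hg F hF.1, hW g hg F hF.2⟩

theorem isInvariantUnder_ker (h : ∀ g ∈ G, tensorPower r (g : Matrix (Fin d) (Fin d) ℝ) * p =
    p * tensorPower r (g : Matrix (Fin d) (Fin d) ℝ)) :
    IsInvariantUnder G (LinearMap.ker p.mulVecLin) := by
  intro g hg F hF
  rw [LinearMap.mem_ker, mulVecLin_apply] at *
  rw [glAct_apply, mulVec_mulVec, ← h g hg, ← mulVec_mulVec, hF, mulVec_zero]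

theorem isInvariantUnder_traceFree : IsInvariantUnder (lorentzGroup d) (traceFree d s) := by
  intro g hg F hF
  rw [glAct_apply]
  exact (mem_lorentzGroup.1 hg).mulVec_mem_traceFree hF

theorem IsInvariantUnder.exists_irreducible (hV : IsInvariantUnder G V) (h0 : V ≠ ⊥) :
    ∃ W ≤ V, IsIrreducibleUnder G W := by
  obtain ⟨W, ⟨hW1, hW2, hW3⟩, hmin⟩ := WellFounded.has_min
    (wellFounded_lt (α := Submodule ℝ (Tensor d r)))
    {W | W ≤ V ∧ W ≠ ⊥ ∧ IsInvariantUnder G W} ⟨V, le_rfl, h0, hV⟩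
  refine ⟨W, hW1, hW2, hW3, fun U hU hUG => ?_⟩
  by_contra! hc
  exact hmin U ⟨hU.trans hW1, hc.1, hUG⟩ (lt_of_le_of_ne hU hc.2)

/-- Induction over invariant subspaces by splitting off irreducible ones. -/
theorem IsInvariantUnder.induction (hG : TransposeClosed G) {P : Submodule ℝ (Tensor d r) → Prop}
    (bot : P ⊥)
    (step : ∀ (V W : Submodule ℝ (Tensor d r)) (p : Matrix (Fin r → Fin d) (Fin r → Fin d) ℝ),
      IsIrreducibleUnder G W → W ≤ V → IsOrthProj p W →
      P (V ⊓ LinearMap.ker p.mulVecLin) → P V) :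
    ∀ V, IsInvariantUnder G V → P V := by
  intro V
  induction V using WellFoundedLT.induction with
  | _ V ih =>
  intro hV
  by_cases h0 : V = ⊥
  · rwa [h0]
  obtain ⟨W, hWV, hW⟩ := hV.exists_irreducible h0
  obtain ⟨p, hp⟩ := exists_isOrthProj W
  refine step V W p hW hWV hp (ih _ ?_
    (hV.inf (isInvariantUnder_ker fun g hg => hW.2.1.commute hG hp hg)))
  refine lt_of_le_of_ne inf_le_left fun h => hW.1 ?_
  rw [Submodule.eq_bot_iff]
  intro F hF
  have h1 : F ∈ V ⊓ LinearMap.ker p.mulVecLin := by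
    rw [h]
    exact hWV hF
  rw [← (hp.mem_iff F).1 hF]
  exact h1.2

/-- The Euclidean orthogonal complement. -/
def euclideanPerp (W : Submodule ℝ (Tensor d r)) : Submodule ℝ (Tensor d r) where
  carrier := {F | ∀ H ∈ W, H ⬝ᵥ F = 0}
  zero_mem' H _ := dotProduct_zero H
  add_mem' hF hF' H hH := by rw [dotProduct_add, hF H hH, hF' H hH, add_zero]
  smul_mem' c F hF H hH := by rw [dotProduct_smul, hF H hH, smul_zero]

theorem IsOrthProj.dotProduct_eq_zero (hp : IsOrthProj p W) {F H : Tensor d r} (hF : F ∈ W)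
    (hH : p *ᵥ H = 0) : F ⬝ᵥ H = 0 := by
  rw [← (hp.mem_iff F).1 hF, dotProduct_comm, dotProduct_mulVec, ← mulVec_transpose, hp.symm, hH,
    zero_dotProduct]

theorem iSupIndep_of_orthogonal {m : ℕ} {W : Fin m → Submodule ℝ (Tensor d r)}
    (h : ∀ i j, i ≠ j → ∀ F ∈ W i, ∀ H ∈ W j, F ⬝ᵥ H = 0) : iSupIndep W := by
  intro i
  have h1 : ⨆ j, ⨆ _ : j ≠ i, W j ≤ euclideanPerp (W i) :=
    iSup₂_le fun j hj H hH F hF => h i j hj.symm F hF H hH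
  rw [Submodule.disjoint_def]
  intro F hF hF'
  exact dotProduct_self_eq_zero.1 (h1 hF' F hF)

/-- Complete reducibility: an invariant subspace is an orthogonal sum of irreducible ones. -/
theorem IsInvariantUnder.exists_decomposition (hG : TransposeClosed G)
    (hV : IsInvariantUnder G V) : ∃ (m : ℕ) (W : Fin m → Submodule ℝ (Tensor d r)),
      (∀ i, IsIrreducibleUnder G (W i)) ∧
      (∀ i j, i ≠ j → ∀ F ∈ W i, ∀ H ∈ W j, F ⬝ᵥ H = 0) ∧ ⨆ i, W i = V := by
  refine IsInvariantUnder.induction hG (P := fun V => ∃ (m : ℕ)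
    (W : Fin m → Submodule ℝ (Tensor d r)), (∀ i, IsIrreducibleUnder G (W i)) ∧
      (∀ i j, i ≠ j → ∀ F ∈ W i, ∀ H ∈ W j, F ⬝ᵥ H = 0) ∧ ⨆ i, W i = V) ?_ ?_ V hV
  · exact ⟨0, fun _ => ⊥, fun i => i.elim0, fun i => i.elim0, by simp⟩
  · rintro V W₀ p hW₀ hle hp ⟨m, W, hirr, horth, hsup⟩
    have hker : ∀ i, ∀ H ∈ W i, p *ᵥ H = 0 := fun i H hH => by
      have : H ∈ V ⊓ LinearMap.ker p.mulVecLin := hsup ▸ Submodule.mem_iSup_of_mem i hH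
      exact this.2
    refine ⟨m + 1, Fin.cons W₀ W, ?_, ?_, ?_⟩
    · intro i
      induction i using Fin.cases with
      | zero => exact hW₀
      | succ i => exact hirr i
    · intro i j hij F hF H hH
      induction i using Fin.cases with
      | zero =>
        induction j using Fin.cases with
        | zero => exact absurd rfl hij
        | succ j => exact hp.dotProduct_eq_zero hF (hker j H hH)
      | succ i =>
        induction j using Fin.cases with
        | zero =>
          rw [dotProduct_comm]
          exact hp.dotProduct_eq_zero hH (hker i F hF)
        | succ j => exact horth i j (fun h => hij (by rw [h])) F hF H hH
    · have h1 : ⨆ i, (Fin.cons W₀ W : Fin (m + 1) → Submodule ℝ (Tensor d r)) i =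
          W₀ ⊔ ⨆ i, W i := by
        refine le_antisymm (iSup_le fun i => ?_) (sup_le ?_ (iSup_le fun i => ?_))
        · induction i using Fin.cases with
          | zero => exact le_sup_left
          | succ i => exact le_sup_of_le_right (le_iSup W i)
        · exact le_iSup (Fin.cons W₀ W : Fin (m + 1) → Submodule ℝ (Tensor d r)) 0
        · exact le_iSup (Fin.cons W₀ W : Fin (m + 1) → Submodule ℝ (Tensor d r)) i.succ
      rw [h1, hsup]
      refine le_antisymm (sup_le hle inf_le_left) fun F hF => ?_
      have h2 : F = p *ᵥ F + (F - p *ᵥ F) := by abel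
      rw [h2]
      refine Submodule.add_mem_sup (hp.mulVec_mem F)
        ⟨V.sub_mem hF (hle (hp.mulVec_mem F)), ?_⟩
      change p *ᵥ (F - p *ᵥ F) = 0
      rw [mulVec_sub, mulVec_mulVec, hp.idem, sub_self]

/-! ### Permutation operators and Schur-type lemmas. -/

theorem permSpan_comm_tensorPower {q : Equiv.Perm (Fin r) → Prop}
    {M : Matrix (Fin r → Fin d) (Fin r → Fin d) ℝ} (hM : M ∈ permSpan d r q)
    (g : Matrix (Fin d) (Fin d) ℝ) : M * tensorPower r g = tensorPower r g * M := by
  induction hM using Submodule.span_induction with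
  | mem M h =>
    obtain ⟨σ, -, rfl⟩ := h
    exact permMatrix_comm_tensorPower σ g
  | zero => simp
  | add M N _ _ h1 h2 => rw [Matrix.add_mul, Matrix.mul_add, h1, h2]
  | smul c M _ h => rw [Matrix.smul_mul, Matrix.mul_smul, h]

theorem permSpan_mulVec_mem_traceFree {q : Equiv.Perm (Fin r) → Prop}
    {M : Matrix (Fin r → Fin d) (Fin r → Fin d) ℝ} (hM : M ∈ permSpan d r q) {F : Tensor d r}
    (hF : F ∈ traceFree d r) : M *ᵥ F ∈ traceFree d r := by
  induction hM using Submodule.span_induction with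
  | mem M h =>
    obtain ⟨σ, -, rfl⟩ := h
    exact permMatrix_mulVec_mem_traceFree σ hF
  | zero => rw [zero_mulVec]; exact Submodule.zero_mem _
  | add M N _ _ h1 h2 => rw [add_mulVec]; exact Submodule.add_mem _ h1 h2
  | smul c M _ h => rw [smul_mulVec]; exact Submodule.smul_mem _ c h

theorem permSpan_transpose_mem {M : Matrix (Fin r → Fin d) (Fin r → Fin d) ℝ}
    (hM : M ∈ permSpan d r fun _ => True) : Mᵀ ∈ permSpan d r fun _ => True := by
  induction hM using Submodule.span_induction with
  | mem M h =>
    obtain ⟨σ, -, rfl⟩ := h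
    rw [permMatrix_transpose]
    exact permMatrix_mem _
  | zero => rw [transpose_zero]; exact Submodule.zero_mem _
  | add M N _ _ h1 h2 => rw [transpose_add]; exact Submodule.add_mem _ h1 h2
  | smul c M _ h => rw [transpose_smul]; exact Submodule.smul_mem _ c h

/-- The orthogonal projection onto a `GL(d)`-invariant subspace is a linear combination of
permutations. -/
theorem IsInvariantUnder.proj_mem_permSpan (hV : IsInvariantUnder ⊤ V) (hp : IsOrthProj p V) :
    p ∈ permSpan d r fun _ => True := by
  apply IsGLInvariant.mem_permSpan
  intro g h hgh
  have := hV.commute transposeClosed_top hp (g := ⟨g, h, hgh, mul_eq_one_comm.1 hgh⟩)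
    (Subgroup.mem_top _)
  change tensorPower r g * p = p * tensorPower r g at this
  rw [this, Matrix.mul_assoc, tensorPower_mul_eq_one hgh, Matrix.mul_one]

theorem IsInvariantUnder.isLorentzEquivariant (hW : IsInvariantUnder (lorentzGroup d) W)
    (hp : IsOrthProj p W) : IsLorentzEquivariant p := by
  intro g hg
  obtain ⟨u, hu, rfl⟩ := hg.exists_unit
  exact hW.commute transposeClosed_lorentzGroup hp hu

/-- Schur's lemma for symmetric operators on a `GL(d)`-irreducible space. -/
theorem IsIrreducibleUnder.exists_eq_smul (hV : IsIrreducibleUnder ⊤ V) (hp : IsOrthProj p V)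
    {x : Matrix (Fin r → Fin d) (Fin r → Fin d) ℝ} (hx : x ∈ permSpan d r fun _ => True)
    (hs : (p * x * p)ᵀ = p * x * p) : ∃ c : ℝ, p * x * p = c • p := by
  by_cases h0 : p * x * p = 0
  · exact ⟨0, by rw [h0, zero_smul]⟩
  obtain ⟨μ, v, hμ, hv, hyv⟩ := exists_eigenvector hs h0
  have hpA := hV.2.1.proj_mem_permSpan hp
  have hpy : p * (p * x * p) = p * x * p := by
    rw [← Matrix.mul_assoc, ← Matrix.mul_assoc, hp.idem]
  have hyp : p * x * p * p = p * x * p := by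
    rw [Matrix.mul_assoc, hp.idem]
  have hyA : p * x * p ∈ permSpan d r fun _ => True :=
    mul_mem_permSpan (fun _ _ _ _ => trivial)
      (mul_mem_permSpan (fun _ _ _ _ => trivial) hpA hx) hpA
  generalize p * x * p = y at *
  refine ⟨μ, ?_⟩
  -- The eigenspace is `GL(d)`-invariant and meets `V` nontrivially, so it contains `V`. Symmetry
  -- served to provide a real eigenvalue.
  let K : Submodule ℝ (Tensor d r) := LinearMap.ker (y - μ • (1 : Matrix _ _ ℝ)).mulVecLin
  have hK : ∀ F, F ∈ K ↔ y *ᵥ F = μ • F := fun F => by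
    rw [LinearMap.mem_ker, mulVecLin_apply, sub_mulVec, smul_mulVec, one_mulVec, sub_eq_zero]
  have hKinv : IsInvariantUnder ⊤ K := isInvariantUnder_ker fun g _ => by
    rw [Matrix.mul_sub, Matrix.sub_mul, permSpan_comm_tensorPower hyA, Matrix.mul_smul,
      Matrix.smul_mul, Matrix.one_mul, Matrix.mul_one]
  have hvV : v ∈ V := by
    rw [hp.mem_iff]
    have : p *ᵥ (μ • v) = μ • v := by rw [← hyv, mulVec_mulVec, hpy]
    rw [mulVec_smul] at this
    exact smul_right_injective _ hμ this
  rcases hV.2.2 (V ⊓ K) inf_le_left (hV.2.1.inf hKinv) with h | h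
  · exact absurd ((Submodule.eq_bot_iff _).1 h v ⟨hvV, (hK v).2 hyv⟩) hv
  · refine ext_mulVec fun F => ?_
    have h1 : p *ᵥ F ∈ V ⊓ K := h.symm ▸ hp.mulVec_mem F
    have h2 := (hK _).1 h1.2
    rwa [mulVec_mulVec, hyp, ← smul_mulVec] at h2

/-- The trace-free part of a `GL(d)`-irreducible space is Lorentz-irreducible or zero. -/
theorem IsIrreducibleUnder.inf_traceFree (hV : IsIrreducibleUnder ⊤ V)
    (h0 : V ⊓ traceFree d r ≠ ⊥) : IsIrreducibleUnder (lorentzGroup d) (V ⊓ traceFree d r) := by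
  have hVL : IsInvariantUnder (lorentzGroup d) V := fun g _ => hV.2.1 g (Subgroup.mem_top g)
  refine ⟨h0, hVL.inf isInvariantUnder_traceFree, fun U hU hUL => ?_⟩
  obtain ⟨u, hu⟩ := exists_isOrthProj U
  obtain ⟨Y, hY⟩ := exists_isOrthProj V
  obtain ⟨Q, hQ⟩ := exists_isOrthProj (traceFree d r)
  obtain ⟨S, hS, huS⟩ := (hUL.isLorentzEquivariant hu).exists_permSpan
  have hYA := hV.2.1.proj_mem_permSpan hY
  obtain ⟨hYu, huY⟩ := hu.mul_eq_of_le hY (hU.trans inf_le_left)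
  obtain ⟨hQu, huQ⟩ := hu.mul_eq_of_le hQ (hU.trans inf_le_right)
  have hcomm : ∀ M ∈ permSpan d r (fun _ => True), M * Q = Q * M := fun M hM =>
    hQ.commute (fun F hF => permSpan_mulVec_mem_traceFree hM hF)
      (fun F hF => permSpan_mulVec_mem_traceFree (permSpan_transpose_mem hM) hF)
  have h1 : u = S * Q := by
    rw [← huQ]
    refine ext_mulVec fun F => ?_
    rw [← mulVec_mulVec, ← mulVec_mulVec, huS _ (hQ.mulVec_mem F)]
  have h2 : u = Sᵀ * Q := by
    have := congrArg transpose h1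
    rwa [hu.symm, transpose_mul, hQ.symm, ← hcomm _ (permSpan_transpose_mem hS)] at this
  -- `S` need not be symmetric, but `u` is, so `S` may be replaced by its transpose. The symmetrised
  -- operator is scalar on `V`, and so `u` is scalar on the trace-free part.
  obtain ⟨c, hc⟩ := hV.exists_eq_smul hY (x := S + Sᵀ)
    (Submodule.add_mem _ hS (permSpan_transpose_mem hS)) (by
      rw [transpose_mul, transpose_mul, hY.symm, transpose_add, transpose_transpose,
        add_comm Sᵀ S, Matrix.mul_assoc])
  have h3 : (2 : ℝ) • u = c • (Y * Q) := by
    calc (2 : ℝ) • u = Y * (2 : ℝ) • u * Y := by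
          rw [Matrix.mul_smul, hYu, Matrix.smul_mul, huY]
      _ = Y * ((S + Sᵀ) * Q) * Y := by
          rw [Matrix.add_mul, ← h1, ← h2, two_smul]
      _ = Y * (S + Sᵀ) * Y * Q := by
          simp only [Matrix.mul_assoc]
          rw [hcomm Y hYA]
      _ = c • (Y * Q) := by rw [hc, Matrix.smul_mul]
  have h4 : ∀ F ∈ V ⊓ traceFree d r, u *ᵥ F = (c / 2) • F := by
    intro F hF
    have h5 := congrArg (fun M => M *ᵥ F) h3
    simp only [smul_mulVec, ← mulVec_mulVec] at h5
    rw [(hQ.mem_iff F).1 hF.2, (hY.mem_iff F).1 hF.1] at h5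
    have h6 : (2 : ℝ) • (u *ᵥ F) = (2 : ℝ) • ((c / 2) • F) := by
      rw [h5, smul_smul]
      congr 1
      ring
    exact smul_right_injective _ (two_ne_zero (α := ℝ)) h6
  by_cases hc0 : c = 0
  · left
    rw [Submodule.eq_bot_iff]
    intro F hF
    rw [← (hu.mem_iff F).1 hF, h4 F (hU hF), hc0, zero_div, zero_smul]
  · right
    refine le_antisymm hU fun F hF => ?_
    have h5 : (c / 2) • F ∈ U := h4 F hF ▸ hu.mulVec_mem F
    exact (Submodule.smul_mem_iff _ (div_ne_zero hc0 two_ne_zero)).1 h5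

/-! ### Multiplicity-freeness in rank at most five. -/

theorem isLorentz_minkowski (d : ℕ) : IsLorentz (minkowski d) := by
  rw [IsLorentz, minkowski_transpose, minkowski_mul_self, Matrix.one_mul]

theorem permAverage_mul (H : Subgroup (Equiv.Perm (Fin r)))
    (M : Matrix (Fin r → Fin d) (Fin r → Fin d) ℝ) (g : Matrix (Fin d) (Fin d) ℝ) :
    permAverage H (M * tensorPower r g) = permAverage H M * tensorPower r g := by
  rw [permAverage, permAverage, Matrix.sum_mul]
  refine Finset.sum_congr rfl fun k _ => ?_
  rw [permMatrix_transpose, Matrix.mul_assoc, Matrix.mul_assoc, Matrix.mul_assoc,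
    Matrix.mul_assoc, ← permMatrix_comm_tensorPower]

theorem mul_permAverage (H : Subgroup (Equiv.Perm (Fin r)))
    (M : Matrix (Fin r → Fin d) (Fin r → Fin d) ℝ) (g : Matrix (Fin d) (Fin d) ℝ) :
    permAverage H (tensorPower r g * M) = tensorPower r g * permAverage H M := by
  rw [permAverage, permAverage, Matrix.mul_sum]
  refine Finset.sum_congr rfl fun k _ => ?_
  rw [← Matrix.mul_assoc, permMatrix_comm_tensorPower]
  simp only [Matrix.mul_assoc]

/-- The Brauer description concerns `TΘ`. As `Θ` is a symmetric involution commuting with `T` and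
with permutations, it cancels from the averaged identity. -/
theorem IsLorentzEquivariant.mem_symmAverage (hr : r ≤ 5)
    {T : Matrix (Fin r → Fin d) (Fin r → Fin d) ℝ} (hT : IsLorentzEquivariant T) :
    T ∈ symmAverage d ⊤ := by
  have hΘΘ : tensorPower r (minkowski d) * tensorPower r (minkowski d) = 1 :=
    tensorPower_mul_eq_one (minkowski_mul_self d)
  have h1 : (permAverage ⊤ (T * tensorPower r (minkowski d)))ᵀ =
      permAverage ⊤ (T * tensorPower r (minkowski d)) :=
    brauerSpan_le_symmAverage hr hT.mem_brauerSpan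
  rw [← hT _ (isLorentz_minkowski d), mul_permAverage] at h1
  have h2 : tensorPower r (minkowski d) * permAverage ⊤ T =
      permAverage ⊤ T * tensorPower r (minkowski d) := by
    rw [← mul_permAverage, hT _ (isLorentz_minkowski d), permAverage_mul]
  have h3 : (tensorPower r (minkowski d))ᵀ = tensorPower r (minkowski d) := by
    rw [← tensorPower_transpose, minkowski_transpose]
  rw [transpose_mul, h3, h2] at h1
  change (permAverage ⊤ T)ᵀ = permAverage ⊤ T
  have h4 := congrArg (fun M => M * tensorPower r (minkowski d)) h1
  simpa only [Matrix.mul_assoc, hΘΘ, Matrix.mul_one] using h4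

/-- A `GL(d)`-irreducible space of tensors of rank at most five is multiplicity-free under the
Lorentz group: distinct irreducible subspaces are orthogonal. -/
theorem IsIrreducibleUnder.eq_or_orthogonal (hr : r ≤ 5) (hV : IsIrreducibleUnder ⊤ V)
    {W W' : Submodule ℝ (Tensor d r)} (hW : IsIrreducibleUnder (lorentzGroup d) W)
    (hW' : IsIrreducibleUnder (lorentzGroup d) W') (hWV : W ≤ V) (hWV' : W' ≤ V) :
    W = W' ∨ ∀ F ∈ W, ∀ H ∈ W', F ⬝ᵥ H = 0 := by
  by_cases hne : W = W'
  · exact Or.inl hne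
  right
  obtain ⟨Y, hY⟩ := exists_isOrthProj V
  obtain ⟨p, hp⟩ := exists_isOrthProj W
  obtain ⟨q, hq⟩ := exists_isOrthProj W'
  have hYA := hV.2.1.proj_mem_permSpan hY
  have hY0 : Y ≠ 0 := by
    rintro rfl
    apply hV.1
    rw [Submodule.eq_bot_iff]
    intro F hF
    rw [← (hY.mem_iff F).1 hF, zero_mulVec]
  have hcompress : ∀ k ∈ (⊤ : Subgroup (Equiv.Perm (Fin r))),
      ∃ c : ℝ, Y * permMatrix d k * Y = c • Y := fun k _ =>
    exists_compress_eq_smul hr hY0 hY.symm hYA (fun x hx hs => hV.exists_eq_smul hY hx hs)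
      (permMatrix_mem k)
  have hpq : Y * (p * q) * Y = p * q := by
    rw [← Matrix.mul_assoc, (hp.mul_eq_of_le hY hWV).1, Matrix.mul_assoc,
      (hq.mul_eq_of_le hY hWV').2]
  have hpqL : IsLorentzEquivariant (p * q) := by
    intro g hg
    rw [← Matrix.mul_assoc, hW.2.1.isLorentzEquivariant hp g hg, Matrix.mul_assoc,
      hW'.2.1.isLorentzEquivariant hq g hg, Matrix.mul_assoc]
  -- Symmetry of `pq` means that the two projections commute, so `pq` maps into `W ⊓ W'`.
  have hsymm := transpose_eq_of_mem_symmAverage hY.symm hY.idem hcompress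
    (x := p * q) (by rw [hpq]; exact hpqL.mem_symmAverage hr)
  rw [hpq, transpose_mul, hp.symm, hq.symm] at hsymm
  have hinf : W ⊓ W' = ⊥ := by
    have hinv := hW.2.1.inf hW'.2.1
    rcases hW.2.2 _ inf_le_left hinv with h | h
    · exact h
    rcases hW'.2.2 _ inf_le_right hinv with h' | h'
    · exact h'
    · exact absurd (h.symm.trans h') hne
  intro F hF H hH
  have h1 : p *ᵥ (q *ᵥ H) ∈ W ⊓ W' :=
    ⟨hp.mulVec_mem _, by rw [mulVec_mulVec, ← hsymm, ← mulVec_mulVec]; exact hq.mulVec_mem _⟩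
  rw [hinf, Submodule.mem_bot, (hq.mem_iff H).1 hH] at h1
  exact hp.dotProduct_eq_zero hF h1

/-! ### Irreducible pieces as symmetrized metrics times trace-free tensors. -/

theorem IsIrreducibleUnder.map {X : Submodule ℝ (Tensor d s)}
    (hX : IsIrreducibleUnder G X) (L : Tensor d s →ₗ[ℝ] Tensor d r)
    (hL : ∀ g ∈ G, ∀ F, L (glAct s g F) = glAct r g (L F)) (h0 : X.map L ≠ ⊥) :
    IsIrreducibleUnder G (X.map L) := by
  refine ⟨h0, ?_, fun U hU hUG => ?_⟩
  · rintro g hg _ ⟨F, hF, rfl⟩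
    exact ⟨_, hX.2.1 g hg F hF, hL g hg F⟩
  · have h1 : IsInvariantUnder G (X ⊓ U.comap L) := fun g hg F hF =>
      ⟨hX.2.1 g hg F hF.1, by
        change L (glAct s g F) ∈ U
        rw [hL g hg]
        exact hUG g hg _ hF.2⟩
    rcases hX.2.2 _ inf_le_left h1 with h | h
    · left
      rw [Submodule.eq_bot_iff]
      intro F hF
      obtain ⟨F', hF', rfl⟩ := hU hF
      rw [(Submodule.eq_bot_iff _).1 h F' ⟨hF', hF⟩, map_zero]
    · right
      refine le_antisymm hU ?_
      rintro _ ⟨F, hF, rfl⟩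
      rw [← h] at hF
      exact hF.2

/-- The trace-free tensors are spanned by the trace-free parts of `GL(d)`-irreducible spaces. -/
theorem traceFree_le_of_irreducible (K : Submodule ℝ (Tensor d s))
    (hK : ∀ V : Submodule ℝ (Tensor d s), IsIrreducibleUnder ⊤ V → V ⊓ traceFree d s ≤ K) :
    traceFree d s ≤ K := by
  have := IsInvariantUnder.induction (transposeClosed_top (d := d))
    (P := fun V : Submodule ℝ (Tensor d s) => V ⊓ traceFree d s ≤ K) (by simp) ?_ ⊤
    (fun _ _ _ _ => Submodule.mem_top)
  · rwa [top_inf_eq] at this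
  · intro V W p hW hWV hp ih F hF
    have hpF : p *ᵥ F ∈ traceFree d s :=
      permSpan_mulVec_mem_traceFree (hW.2.1.proj_mem_permSpan hp) hF.2
    have h2 : F = p *ᵥ F + (F - p *ᵥ F) := by abel
    rw [h2]
    refine K.add_mem (hK W hW ⟨hp.mulVec_mem F, hpF⟩) (ih ⟨⟨V.sub_mem hF.1
      (hWV (hp.mulVec_mem F)), ?_⟩, Submodule.sub_mem _ hF.2 hpF⟩)
    change p *ᵥ (F - p *ᵥ F) = 0
    rw [mulVec_sub, mulVec_mulVec, hp.idem, sub_self]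

theorem toLin'_mem_permutationAlgebra {M : Matrix (Fin r → Fin d) (Fin r → Fin d) ℝ}
    {q : Equiv.Perm (Fin r) → Prop} (hM : M ∈ permSpan d r q) :
    Matrix.toLin' M ∈ permutationAlgebra d r := by
  induction hM using Submodule.span_induction with
  | mem M h =>
    obtain ⟨σ, -, rfl⟩ := h
    rw [toMatrix'_permuteIndices]
    exact Submodule.subset_span ⟨σ, rfl⟩
  | zero => rw [map_zero]; exact Submodule.zero_mem _
  | add M N _ _ h1 h2 => rw [map_add]; exact Submodule.add_mem _ h1 h2
  | smul c M _ h => rw [map_smul]; exact Submodule.smul_mem _ c h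

/-- A Lorentz-irreducible subspace of a `GL(d)`-irreducible space of tensors of rank at most five
consists of symmetrized products of metrics and trace-free tensors. -/
theorem IsIrreducibleUnder.isMetricTimesTraceFree (hr : r ≤ 5) (hV : IsIrreducibleUnder ⊤ V)
    {Y : Matrix (Fin r → Fin d) (Fin r → Fin d) ℝ} (hY : IsOrthProj Y V)
    (hW : IsIrreducibleUnder (lorentzGroup d) W) (hWV : W ≤ V) :
    IsMetricTimesTraceFree (Matrix.toLin' Y) W := by
  obtain ⟨F, hFW, hF0⟩ := (Submodule.ne_bot_iff _).1 hW.1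
  have hYF : Y *ᵥ F = F := (hY.mem_iff F).1 (hWV hFW)
  have hYA := hV.2.1.proj_mem_permSpan hY
  obtain ⟨t, s, σ, V', hV', f, hf, hne⟩ : ∃ (t s : ℕ) (σ : (Fin t × Fin 2) ⊕ Fin s ≃ Fin r)
      (V' : Submodule ℝ (Tensor d s)), IsIrreducibleUnder ⊤ V' ∧
      ∃ f ∈ V' ⊓ traceFree d s, F ⬝ᵥ metricMul σ f ≠ 0 := by
    by_contra! hc
    refine hF0 (eq_zero_of_orthogonal_metricMul F fun t s σ f hf => ?_)
    have h1 := traceFree_le_of_irreducible ((euclideanPerp (Submodule.span ℝ {F})).comap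
      (metricMulLin d σ)) (fun V' hV' f hf H hH => by
        obtain ⟨c, rfl⟩ := Submodule.mem_span_singleton.1 hH
        rw [smul_dotProduct]
        exact (congrArg (c • ·) (hc t s σ V' hV' f hf)).trans (smul_zero c)) hf
    rw [dotProduct_comm]
    exact h1 F (Submodule.mem_span_singleton_self F)
  have hX := hV'.inf_traceFree ((Submodule.ne_bot_iff _).2 ⟨f, hf, by
    rintro rfl
    apply hne
    have : metricMul (d := d) σ 0 = 0 := map_zero (metricMulLin d σ)
    rw [this, dotProduct_zero]⟩)
  let L : Tensor d s →ₗ[ℝ] Tensor d r := Matrix.toLin' Y ∘ₗ metricMulLin d σ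
  have hL : ∀ f, L f = Y *ᵥ metricMul σ f := fun f => Matrix.toLin'_apply _ _
  have hFL : F ⬝ᵥ L f ≠ 0 := by
    rwa [hL, dotProduct_mulVec, ← mulVec_transpose, hY.symm, hYF]
  -- `L` is Lorentz-equivariant and nonzero on the irreducible trace-free part, so its image is
  -- irreducible. The image lies in `V` and is not orthogonal to `W`, so multiplicity-freeness
  -- forces equality.
  have hZ := hX.map L (fun g hg H => by
    rw [hL, glAct_apply, glAct_apply, hL,
      ← (mem_lorentzGroup.1 hg).tensorPower_mulVec_metricMul, mulVec_mulVec, mulVec_mulVec,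
      permSpan_comm_tensorPower hYA])
    ((Submodule.ne_bot_iff _).2 ⟨L f, ⟨f, hf, rfl⟩, fun h => hFL (by rw [h, dotProduct_zero])⟩)
  have hZV : (V' ⊓ traceFree d s).map L ≤ V := by
    rintro _ ⟨H, -, rfl⟩
    rw [hL]
    exact hY.mulVec_mem _
  rcases hV.eq_or_orthogonal hr hW hZ hWV hZV with h | h
  · refine ⟨t, s, σ, V', hV', ?_⟩
    rw [h]
    ext H
    constructor
    · rintro ⟨f, hf, rfl⟩
      exact ⟨f, hf.1, hf.2, rfl⟩
    · rintro ⟨f, hf1, hf2, rfl⟩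
      exact ⟨f, ⟨hf1, hf2⟩, rfl⟩
  · exact absurd (h F hFW _ ⟨f, hf, rfl⟩) hFL

theorem tensorMetric_apply (F H : Tensor d r) :
    tensorMetric d r F H = F ⬝ᵥ (tensorPower r (minkowski d) *ᵥ H) := by
  rw [tensorMetric, Matrix.toBilin'_apply']

theorem IsInvariantUnder.minkowski_mulVec_mem (hW : IsInvariantUnder (lorentzGroup d) W)
    {F : Tensor d r} (hF : F ∈ W) : tensorPower r (minkowski d) *ᵥ F ∈ W := by
  obtain ⟨u, hu, hu'⟩ := (isLorentz_minkowski d).exists_unit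
  rw [← hu', ← glAct_apply]
  exact hW u hu F hF

theorem tensorMetric_isSymm (d r : ℕ) (F H : Tensor d r) :
    tensorMetric d r F H = tensorMetric d r H F := by
  rw [tensorMetric_apply, tensorMetric_apply, dotProduct_mulVec, ← mulVec_transpose,
    ← tensorPower_transpose, minkowski_transpose, dotProduct_comm]

/-- Pair `F` with `ΘF`, which again lies in `W`: since `Θ² = 1` the value is `F ⬝ F`. -/
theorem IsInvariantUnder.tensorMetric_nondegenerate
    (hW : IsInvariantUnder (lorentzGroup d) W) :
    ((tensorMetric d r).restrict W).Nondegenerate := by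
  have key : ∀ F ∈ W, (∀ H ∈ W, tensorMetric d r F H = 0) → F = 0 := by
    intro F hF h
    have h1 := h _ (hW.minkowski_mulVec_mem hF)
    rw [tensorMetric_apply, mulVec_mulVec, tensorPower_mul_eq_one (minkowski_mul_self d),
      one_mulVec] at h1
    exact dotProduct_self_eq_zero.1 h1
  constructor
  · intro F h
    exact Subtype.ext (key F F.2 fun H hH => h ⟨H, hH⟩)
  · intro F h
    exact Subtype.ext (key F F.2 fun H hH => by
      rw [tensorMetric_isSymm]
      exact h ⟨H, hH⟩)

end Invariant

/-! ### The main theorem. -/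

theorem mainTheorem2 (d r : ℕ) (hd : 1 ≤ d) (hr : r ≤ 5) (V : Submodule ℝ (Tensor d r))
    (hV : IsIrreducibleUnder ⊤ V) :
    (∃ (m : ℕ) (W : Fin m → Submodule ℝ (Tensor d r)), IsLorentzDecomposition V W) ∧
    ∃ Y ∈ permutationAlgebra d r, LinearMap.IsProj V Y ∧
      ∀ (m : ℕ) (W : Fin m → Submodule ℝ (Tensor d r)), IsLorentzDecomposition V W →
        (∀ i, IsMetricTimesTraceFree Y (W i)) ∧
        (∀ i j, i ≠ j → ∀ F ∈ W i, ∀ G ∈ W j, tensorMetric d r F G = 0) ∧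
        ∀ i, ((tensorMetric d r).restrict (W i)).Nondegenerate := by
  constructor
  · have hVL : IsInvariantUnder (lorentzGroup d) V := fun g _ => hV.2.1 g (Subgroup.mem_top g)
    obtain ⟨m, W, h1, h2, h3⟩ := hVL.exists_decomposition transposeClosed_lorentzGroup
    exact ⟨m, W, h1, iSupIndep_of_orthogonal h2, h3⟩
  obtain ⟨Y, hY⟩ := exists_isOrthProj V
  refine ⟨Matrix.toLin' Y, toLin'_mem_permutationAlgebra (hV.2.1.proj_mem_permSpan hY),
    ⟨fun F => hY.mulVec_mem F, fun F hF => (hY.mem_iff F).1 hF⟩, fun m W hW => ?_⟩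
  have hle : ∀ i, W i ≤ V := fun i => hW.span ▸ le_iSup W i
  refine ⟨fun i => hV.isMetricTimesTraceFree hr hY (hW.irreducible i) (hle i), ?_,
    fun i => (hW.irreducible i).2.1.tensorMetric_nondegenerate⟩
  intro i j hij F hF G hG
  rw [tensorMetric_apply]
  -- Two summands cannot coincide, being disjoint and nonzero. Euclidean orthogonality, applied to
  -- `ΘG` in `W j`, is orthogonality for the metric.
  rcases hV.eq_or_orthogonal hr (hW.irreducible i) (hW.irreducible j) (hle i) (hle j) with h | h
  · have h1 := hW.independent.pairwiseDisjoint hij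
    change Disjoint (W i) (W j) at h1
    rw [← h, disjoint_self] at h1
    exact absurd h1 (hW.irreducible i).1
  · exact h F hF _ ((hW.irreducible j).2.1.minkowski_mulVec_mem hG)
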